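/- Let $M$ be a finite-dimensional Hausdorff $C^\infty$ manifold and let $A:TM\to TM$ be an operator field, that is, a smooth $(1,1)$ tensor field. Define the generalized Nijenhuis torsions of $A$ recursively, for smooth vector fields $X,Y$, by $\tau^{(0)}_A(X,Y)=[X,Y]$ and, for $m\ge 1$, $$\tau^{(m)}_A(X,Y)=A^2\tau^{(m-1)}_A(X,Y)+\tau^{(m-1)}_A(AX,AY)-A\big(\tau^{(m-1)}_A(X,AY)+\tau^{(m-1)}_A(AX,Y)\big).$$ Thus $\tau^{(1)}_A$ is the Nijenhuis torsion and $\tau^{(2)}_A$ the Haantjes torsion of $A$. Assume that all eigenvalues of $A$ are real and that the distinct ones are given by continuous functions $\lambda_1,\dots,\lambda_s:M\to\mathbb R$: for every $x\in M$ the numbers $\lambda_1(x),\dots,\lambda_s(x)$ are pairwise distinct and are exactly the eigenvalues of $A(x)$. Let $$\mathcal D_i(x)=\ker\big(A(x)-\lambda_i(x)I\big)^{\rho_i(x)}\subseteq T_xM,\qquad i=1,\dots,s,$$ be the generalized eigen-distributions of $A$, where the Riesz index $\rho_i(x)$ is the least integer $\rho$ with $\ker(A(x)-\lambda_i(x)I)^{\rho}=\ker(A(x)-\lambda_i(x)I)^{\rho+1}$.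 Assume that for each $i$ the dimension of $\mathcal D_i(x)$ does not depend on $x$. If there is an integer $m\ge 1$ such that $\tau^{(m)}_A(X,Y)=0$ for all smooth vector fields $X,Y$ on $M$, then each generalized eigen-distribution $\mathcal D_i$ is integrable, and so is each sum $\bigoplus_{i\in S}\mathcal D_i$ with $S\subseteq\{1,\dots,s\}$. Here a distribution $\mathcal D$ is called integrable (in the sense of Frobenius) if every point of $M$ lies in the domain of a smooth chart $(x^1,\dots,x^n)$ of $M$ on which $\mathcal D$ is spanned by $\partial/\partial x^1,\dots,\partial/\partial x^k$ for some $k$. -/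

import Mathlib

open scoped Manifold ContDiff

noncomputable section

namespace NijenhuisHaantjes

variable {E : Type*} [NormedAddCommGroup E] [NormedSpace ℝ E]
  {M : Type*} [TopologicalSpace M] [ChartedSpace E M]

/-- A (not necessarily continuous) vector field on `M`. -/
abbrev VField (E : Type*) [NormedAddCommGroup E] [NormedSpace ℝ E]
    (M : Type*) [TopologicalSpace M] [ChartedSpace E M] : Type _ :=
  ∀ x : M, TangentSpace 𝓘(ℝ, E) x

/-- A (not necessarily continuous) field of linear operators on the tangent spaces of `M`. -/
abbrev OpField (E : Type*) [NormedAddCommGroup E] [NormedSpace ℝ E]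
    (M : Type*) [TopologicalSpace M] [ChartedSpace E M] : Type _ :=
  ∀ x : M, TangentSpace 𝓘(ℝ, E) x →L[ℝ] TangentSpace 𝓘(ℝ, E) x

/-- A field of linear subspaces of the tangent spaces of `M`. -/
abbrev Distribution (E : Type*) [NormedAddCommGroup E] [NormedSpace ℝ E]
    (M : Type*) [TopologicalSpace M] [ChartedSpace E M] : Type _ :=
  ∀ x : M, Submodule ℝ (TangentSpace 𝓘(ℝ, E) x)

/-- The vector field is a smooth section of the tangent bundle. -/
def VField.IsSmooth [IsManifold 𝓘(ℝ, E) ∞ M] (X : VField E M) : Prop :=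
  ContMDiff 𝓘(ℝ, E) (𝓘(ℝ, E).prod 𝓘(ℝ, E)) ∞
    (fun x : M => Bundle.TotalSpace.mk' E (E := (TangentSpace 𝓘(ℝ, E) : M → Type _)) x (X x))

/-- The operator field is a smooth section of the bundle `End(TM)`, that is, a smooth
`(1,1)` tensor field. -/
def OpField.IsSmooth [IsManifold 𝓘(ℝ, E) ∞ M] (A : OpField E M) : Prop :=
  ContMDiff 𝓘(ℝ, E) (𝓘(ℝ, E).prod 𝓘(ℝ, E →L[ℝ] E)) ∞
    (fun x : M => Bundle.TotalSpace.mk' (E →L[ℝ] E)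
      (E := fun x : M => TangentSpace 𝓘(ℝ, E) x →L[ℝ] TangentSpace 𝓘(ℝ, E) x) x (A x))

/-- All eigenvalues of the operator `f` are real: its characteristic polynomial is a product of
linear factors over `ℝ`. -/
def HasRealEigenvalues [FiniteDimensional ℝ E] (f : E →L[ℝ] E) : Prop :=
  f.toLinearMap.charpoly.Splits

/-- All eigenvalues of `A(x)` are real, for every `x`. -/
def OpField.HasRealSpectrum [FiniteDimensional ℝ E] (A : OpField E M) : Prop :=
  ∀ x : M, HasRealEigenvalues (E := E) (A x)

/-- The vector field `AX`. -/
def OpField.app (A : OpField E M) (X : VField E M) : VField E M :=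
  fun x => A x (X x)

/-- The generalized Nijenhuis torsion of level `m` of `A`, as an operation on pairs of vector
fields. Level `0` is the Lie bracket, level `1` the Nijenhuis torsion, level `2` the Haantjes
torsion. -/
def torsion (A : OpField E M) : ℕ → VField E M → VField E M → VField E M
  | 0, X, Y => VectorField.mlieBracket 𝓘(ℝ, E) X Y
  | m + 1, X, Y =>
      A.app (A.app (torsion A m X Y)) + torsion A m (A.app X) (A.app Y)
        - A.app (torsion A m X (A.app Y) + torsion A m (A.app X) Y)

/-- The generalized eigen-distribution of `A` for the eigenvalue field `μ`: at `x` it is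
`ker ((A(x) - μ(x) I) ^ ρ(x))`, where `ρ(x)` is the Riesz index of `μ(x)`, equivalently
the union of the kernels of all powers of `A(x) - μ(x) I`. -/
def eigenDistribution (A : OpField E M) (μ : M → ℝ) : Distribution E M :=
  fun x => Module.End.maxGenEigenspace (A x).toLinearMap (μ x)

/-- Frobenius integrability: around every point there is a chart of the smooth structure of `M`
in which the distribution is constant. In suitable linear coordinates the
distribution is then spanned in the domain of the chart by the first `k` coordinate fields, and
the slices of the chart are integral manifolds. -/
def Distribution.IsIntegrable (D : Distribution E M) : Prop :=
  ∀ x : M, ∃ φ ∈ IsManifold.maximalAtlas 𝓘(ℝ, E) ∞ M, x ∈ φ.source ∧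
    ∃ W : Submodule ℝ E, ∀ y ∈ φ.source, ∀ v : TangentSpace 𝓘(ℝ, E) y,
      v ∈ D y ↔ mfderiv 𝓘(ℝ, E) 𝓘(ℝ, E) φ y v ∈ W

end NijenhuisHaantjes

end

open scoped Manifold ContDiff Topology

noncomputable section

namespace NijenhuisHaantjes

open Filter Set

/-! By Frobenius, it suffices to show that the distributions are smooth of constant rank and
involutive.

Involutivity is algebraic. On biadditive maps, applying `A` to the value, to the first slot or to
the second slot gives three commuting operators `a`, `b`, `c`, and the torsion of level `m` is `(a -
b)^m (a - c)^m` applied to the Lie bracket. Replace `A` by `A - μ` in the first factor and by `A -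
ν` in the second, with `μ`, `ν` smooth functions. The bracket is not function-linear, but its defect
is the Leibniz term, which is tensorial in the vector it carries; for `m ≥ 2` all correction terms
vanish, so the shifted expression is zero as well. If `(A - μ)^N X = 0` and `(A - ν)^N Y = 0`, the
slot operators act nilpotently, and a nilpotence argument gives `((A - μ)(A - ν))^K [X, Y] = 0`
(`exists_pow_bracket_eq_zero`). Hence the bracket lies in the sum of the two generalized eigenspaces
(`mlieBracket_mem_iSup_eigenDistribution`).

Smoothness: constant rank means constant algebraic multiplicity, so each continuous eigenvalue is
smooth, being a simple root of a derivative of the characteristic polynomial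
(`contDiffAt_of_rootMultiplicity_eq`). A sum of generalized eigenspaces is then the kernel of a
smooth operator family, a polynomial in `A` with smooth coefficients.

The Frobenius theorem is proved for such kernels (`exists_flat_chart_of_ker`) by solving a total
differential equation; smooth dependence on parameters comes from the inverse function theorem in a
space of continuous paths (`exists_solution_total_differential`). -/

lemma addMonoidEnd_sub_apply {W : Type*} [AddCommGroup W] (f g : AddMonoid.End W) (w : W) :
    (f - g) w = f w - g w := rfl

/-! ### Commuting operators on biadditive maps, and the torsion as a product of their powers. -/

section Biadditive

variable {V : Type*} [AddCommGroup V]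

/-- Postcomposition of a biadditive map with an endomorphism. -/
def postOp (f : AddMonoid.End V) : AddMonoid.End (V →+ V →+ V) where
  toFun Ψ := Ψ.compr₂ f
  map_zero' := AddMonoidHom.ext fun _ => AddMonoidHom.ext fun _ => map_zero f
  map_add' _ _ := AddMonoidHom.ext fun _ => AddMonoidHom.ext fun _ => map_add f _ _

/-- Precomposition of the first argument of a biadditive map with an endomorphism. -/
def fstOp (f : AddMonoid.End V) : AddMonoid.End (V →+ V →+ V) where
  toFun Ψ := Ψ.comp f
  map_zero' := rfl
  map_add' _ _ := rfl

/-- Precomposition of the second argument of a biadditive map with an endomorphism. -/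
def sndOp (f : AddMonoid.End V) : AddMonoid.End (V →+ V →+ V) where
  toFun Ψ := Ψ.compl₂ f
  map_zero' := rfl
  map_add' _ _ := rfl

@[simp] lemma postOp_apply (f : AddMonoid.End V) (Ψ : V →+ V →+ V) (X Y : V) :
    postOp f Ψ X Y = f (Ψ X Y) := rfl

@[simp] lemma fstOp_apply (f : AddMonoid.End V) (Ψ : V →+ V →+ V) (X Y : V) :
    fstOp f Ψ X Y = Ψ (f X) Y := rfl

@[simp] lemma sndOp_apply (f : AddMonoid.End V) (Ψ : V →+ V →+ V) (X Y : V) :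
    sndOp f Ψ X Y = Ψ X (f Y) := rfl

lemma biadditive_op_ext {S T : AddMonoid.End (V →+ V →+ V)}
    (h : ∀ Ψ X Y, S Ψ X Y = T Ψ X Y) : S = T :=
  AddMonoidHom.ext fun Ψ => AddMonoidHom.ext fun X => AddMonoidHom.ext fun Y => h Ψ X Y

lemma postOp_sub (f g : AddMonoid.End V) : postOp (f - g) = postOp f - postOp g :=
  biadditive_op_ext fun Ψ X Y => by
    simp [addMonoidEnd_sub_apply, AddMonoidHom.sub_apply]

lemma fstOp_sub (f g : AddMonoid.End V) : fstOp (f - g) = fstOp f - fstOp g :=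
  biadditive_op_ext fun Ψ X Y => by
    simp [addMonoidEnd_sub_apply, AddMonoidHom.sub_apply]

lemma sndOp_sub (f g : AddMonoid.End V) : sndOp (f - g) = sndOp f - sndOp g :=
  biadditive_op_ext fun Ψ X Y => by
    simp [addMonoidEnd_sub_apply, AddMonoidHom.sub_apply]

lemma commute_postOp_fstOp (f g : AddMonoid.End V) : Commute (postOp f) (fstOp g) :=
  biadditive_op_ext fun _ _ _ => rfl

lemma commute_postOp_sndOp (f g : AddMonoid.End V) : Commute (postOp f) (sndOp g) :=
  biadditive_op_ext fun _ _ _ => rfl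

lemma commute_fstOp_sndOp (f g : AddMonoid.End V) : Commute (fstOp f) (sndOp g) :=
  biadditive_op_ext fun _ _ _ => rfl

lemma commute_postOp {f g : AddMonoid.End V} (h : Commute f g) :
    Commute (postOp f) (postOp g) :=
  biadditive_op_ext fun Ψ X Y => DFunLike.congr_fun h.eq (Ψ X Y)

lemma commute_fstOp {f g : AddMonoid.End V} (h : Commute f g) :
    Commute (fstOp f) (fstOp g) :=
  biadditive_op_ext fun Ψ X Y =>
    congrArg (fun Z => Ψ Z Y) (DFunLike.congr_fun h.symm.eq X)

lemma commute_sndOp {f g : AddMonoid.End V} (h : Commute f g) :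
    Commute (sndOp f) (sndOp g) :=
  biadditive_op_ext fun Ψ X Y => congrArg (Ψ X) (DFunLike.congr_fun h.symm.eq Y)

lemma postOp_pow_apply (f : AddMonoid.End V) (n : ℕ) (Ψ : V →+ V →+ V) (X Y : V) :
    (postOp f ^ n) Ψ X Y = (f ^ n) (Ψ X Y) := by
  induction n generalizing Ψ with
  | zero => rfl
  | succ n ih => rw [pow_succ, pow_succ]; exact ih (postOp f Ψ)

lemma fstOp_pow_apply (f : AddMonoid.End V) (n : ℕ) (Ψ : V →+ V →+ V) (X Y : V) :
    (fstOp f ^ n) Ψ X Y = Ψ ((f ^ n) X) Y := by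
  induction n generalizing Ψ with
  | zero => rfl
  | succ n ih => rw [pow_succ, pow_succ']; exact ih (fstOp f Ψ)

lemma sndOp_pow_apply (f : AddMonoid.End V) (n : ℕ) (Ψ : V →+ V →+ V) (X Y : V) :
    (sndOp f ^ n) Ψ X Y = Ψ X ((f ^ n) Y) := by
  induction n generalizing Ψ with
  | zero => rfl
  | succ n ih => rw [pow_succ, pow_succ']; exact ih (sndOp f Ψ)

/-- The generalized torsion of level `m` of an endomorphism with respect to a bracket. -/
def torsionOp (A : AddMonoid.End V) (m : ℕ) : AddMonoid.End (V →+ V →+ V) :=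
  (postOp A - fstOp A) ^ m * (postOp A - sndOp A) ^ m

lemma commute_torsionOp_factors (A : AddMonoid.End V) :
    Commute (postOp A - fstOp A) (postOp A - sndOp A) :=
  (((Commute.refl _).sub_right (commute_postOp_sndOp A A))).sub_left
    ((commute_postOp_fstOp A A).symm.sub_right (commute_fstOp_sndOp A A))

lemma torsionOp_zero_apply (A : AddMonoid.End V) (Ψ : V →+ V →+ V) : torsionOp A 0 Ψ = Ψ := by
  rw [torsionOp, pow_zero, pow_zero, one_mul]; rfl

/-- Expanding `(a - b)(a - c) = a² + bc - ac - ab` gives the recursion that defines the generalized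
torsions. -/
lemma torsionOp_succ_apply (A : AddMonoid.End V) (m : ℕ) (Ψ : V →+ V →+ V) (X Y : V) :
    torsionOp A (m + 1) Ψ X Y =
      A (A (torsionOp A m Ψ X Y)) + torsionOp A m Ψ (A X) (A Y)
        - A (torsionOp A m Ψ X (A Y) + torsionOp A m Ψ (A X) Y) := by
  have h : torsionOp A (m + 1) =
      ((postOp A - fstOp A) * (postOp A - sndOp A)) * torsionOp A m := by
    have hc := commute_torsionOp_factors A
    rw [torsionOp, torsionOp, ← hc.mul_pow, ← hc.mul_pow, pow_succ']
  rw [h]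
  generalize hT : torsionOp A m Ψ = T
  have : ((postOp A - fstOp A) * (postOp A - sndOp A) * torsionOp A m) Ψ X Y
      = ((postOp A - fstOp A) ((postOp A - sndOp A) T)) X Y := by rw [← hT]; rfl
  rw [this]
  simp only [addMonoidEnd_sub_apply, AddMonoidHom.sub_apply, postOp_apply, fstOp_apply,
    sndOp_apply, map_sub, map_add]
  abel

end Biadditive

/-! ### Nilpotence in commutative rings, and removal of correction terms. -/

section Nilpotent

/-- Modulo the three generators on the right, `β`, `δ` and `(α - β)(γ - δ)` are nilpotent, hence so
is `αγ = (α - β)(γ - δ) + βγ + δ(α - β)`. -/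
lemma exists_pow_mul_eq_of_nilpotent {R : Type*} [CommRing R] (α β γ δ : R) (m N : ℕ) :
    ∃ (K : ℕ) (u v w : R),
      (α * γ) ^ K = u * ((α - β) ^ m * (γ - δ) ^ m) + β ^ N * v + δ ^ N * w := by
  set I : Ideal R := Ideal.span {(α - β) ^ m * (γ - δ) ^ m, β ^ N, δ ^ N}
  let q := Ideal.Quotient.mk I
  have hβ : IsNilpotent (q β) := ⟨N, by
    rw [← map_pow, Ideal.Quotient.eq_zero_iff_mem]; exact Ideal.subset_span (by simp)⟩
  have hδ : IsNilpotent (q δ) := ⟨N, by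
    rw [← map_pow, Ideal.Quotient.eq_zero_iff_mem]; exact Ideal.subset_span (by simp)⟩
  have hp : IsNilpotent (q ((α - β) * (γ - δ))) := ⟨m, by
    rw [← map_pow, mul_pow, Ideal.Quotient.eq_zero_iff_mem]
    exact Ideal.subset_span (by simp)⟩
  have hz : IsNilpotent (q (α * γ)) := by
    have : q (α * γ) = q ((α - β) * (γ - δ)) + (q β * q γ + q δ * q (α - β)) := by
      rw [← map_mul, ← map_mul, ← map_add, ← map_add]; ring_nf
    rw [this]
    exact (Commute.all _ _).isNilpotent_add hp ((Commute.all _ _).isNilpotent_add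
      ((Commute.all _ _).isNilpotent_mul_right hβ) ((Commute.all _ _).isNilpotent_mul_right hδ))
  obtain ⟨K, hK⟩ := hz
  rw [← map_pow, Ideal.Quotient.eq_zero_iff_mem, Ideal.mem_span_insert] at hK
  obtain ⟨u, z, hz, h⟩ := hK
  obtain ⟨v, w, h2⟩ := Ideal.mem_span_pair.1 hz
  exact ⟨K, u, v, w, by rw [h, ← h2]; ring⟩

/-- Pairwise commuting elements generate a commutative subring, where the commutative case applies.
In the application `β` and `δ` act on the two slots of the bracket. -/
lemma exists_pow_mul_eq_of_commute {R : Type*} [Ring R] {α β γ δ : R}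
    (hαβ : Commute α β) (hαγ : Commute α γ) (hαδ : Commute α δ) (hβγ : Commute β γ)
    (hβδ : Commute β δ) (hγδ : Commute γ δ) (m N : ℕ) :
    ∃ (K : ℕ) (u v w : R),
      (α * γ) ^ K = u * ((α - β) ^ m * (γ - δ) ^ m) + β ^ N * v + δ ^ N * w := by
  let s : Set R := {α, β, γ, δ}
  have hs : ∀ a ∈ s, ∀ b ∈ s, a * b = b * a := by
    have := hαβ.eq; have := hαγ.eq; have := hαδ.eq; have := hβγ.eq; have := hβδ.eq
    have := hγδ.eq
    rintro a (rfl | rfl | rfl | rfl) b (rfl | rfl | rfl | rfl) <;> simp_all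
  have := Algebra.isMulCommutative_adjoin ℤ hs
  let _ : CommRing (Algebra.adjoin ℤ s) :=
    { (inferInstance : Ring (Algebra.adjoin ℤ s)) with mul_comm := mul_comm' }
  have mem : ∀ a ∈ s, a ∈ Algebra.adjoin ℤ s := fun a ha => Algebra.subset_adjoin ha
  obtain ⟨K, u, v, w, h⟩ := exists_pow_mul_eq_of_nilpotent
    (⟨α, mem α (by simp [s])⟩ : Algebra.adjoin ℤ s) ⟨β, mem β (by simp [s])⟩
    ⟨γ, mem γ (by simp [s])⟩ ⟨δ, mem δ (by simp [s])⟩ m N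
  exact ⟨K, u, v, w, congrArg Subtype.val h⟩

/-- Every term of the binomial expansion other than `u ^ m` contains `u v` or `v²` once `m ≥ 2`; for
`m = 1` the term `v w` would survive. -/
lemma sub_pow_apply_eq_of_sq {W : Type*} [AddCommGroup W] {u v : AddMonoid.End W}
    (huv : Commute u v) {w : W} (h1 : u (v w) = 0) (h2 : v (v w) = 0) {m : ℕ} (hm : 2 ≤ m) :
    ((u - v) ^ m) w = (u ^ m) w := by
  have h3 : v (u w) = 0 := by rw [← h1]; exact (DFunLike.congr_fun huv.eq w).symm
  obtain ⟨k, rfl⟩ := Nat.exists_eq_add_of_le' hm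
  clear hm
  induction k with
  | zero =>
    simp only [zero_add, sq]
    change (u - v) ((u - v) w) = u (u w)
    simp [addMonoidEnd_sub_apply, h1, h2, h3]
  | succ k ih =>
    have e : v ((u ^ (k + 2)) w) = 0 := by
      have : v ((u ^ (k + 2)) w) = (u ^ (k + 1)) (v (u w)) := by
        have h : v * u ^ (k + 2) = u ^ (k + 1) * (v * u) := by
          rw [pow_succ u (k + 1), ← mul_assoc, (huv.symm.pow_right (k + 1)).eq, mul_assoc]
        exact DFunLike.congr_fun h w
      rw [this, h3, map_zero]
    rw [show k + 1 + 2 = (k + 2) + 1 from rfl, pow_succ' _ (k + 2), pow_succ' _ (k + 2)]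
    change (u - v) (((u - v) ^ (k + 2)) w) = u ((u ^ (k + 2)) w)
    rw [ih, addMonoidEnd_sub_apply, e, sub_zero]

end Nilpotent

/-! ### Brackets of generalized eigenvectors over a ring of functions. -/

section Leibniz

variable {C V : Type*} [CommRing C] [AddCommGroup V] [Module C V]

/-- The additive endomorphism underlying a linear one. -/
abbrev addEnd (A : Module.End C V) : AddMonoid.End V := A.toAddMonoidHom

lemma addEnd_pow_apply (A : Module.End C V) (n : ℕ) (X : V) :
    (addEnd A ^ n) X = (A ^ n) X := by
  induction n generalizing X with
  | zero => rfl
  | succ n ih => rw [pow_succ, pow_succ]; exact ih (A X)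

/-- The action of a scalar, as an additive endomorphism. -/
abbrev scalarEnd (V : Type*) [AddCommGroup V] [Module C V] (f : C) : AddMonoid.End V :=
  addEnd (algebraMap C (Module.End C V) f)

lemma commute_addEnd_scalarEnd (A : Module.End C V) (f : C) :
    Commute (addEnd A) (scalarEnd V f) :=
  AddMonoidHom.ext fun X => A.map_smul f X

/-- If the torsion of level `m ≥ 2` vanishes, the bracket of a vector annihilated by a power of
`A - μ` and a vector annihilated by a power of `A - ν` is annihilated by a power of
`(A - μ) (A - ν)`. Here `D` is the derivation term of the Leibniz rule. -/
lemma exists_pow_bracket_eq_zero (A : Module.End C V) (Φ : V →+ V →+ V) (D : V → C → V → V)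
    (hDA : ∀ X f Y, A (D X f Y) = D X f (A Y))
    (hDC : ∀ X f (g : C) Y, g • D X f Y = D X f (g • Y))
    (hleft : ∀ (f : C) (X Y : V), Φ (f • X) Y = f • Φ X Y - D Y f X)
    (hright : ∀ (f : C) (X Y : V), Φ X (f • Y) = f • Φ X Y + D X f Y)
    {m : ℕ} (hm : 2 ≤ m) (htors : torsionOp (addEnd A) m Φ = 0) (μ ν : C) (N : ℕ) {X Y : V}
    (hX : ((A - algebraMap C _ μ) ^ N) X = 0) (hY : ((A - algebraMap C _ ν) ^ N) Y = 0) :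
    ∃ K : ℕ, (((A - algebraMap C _ μ) * (A - algebraMap C _ ν)) ^ K) (Φ X Y) = 0 := by
  set B := A - algebraMap C (Module.End C V) μ with hB
  set G := A - algebraMap C (Module.End C V) ν with hG
  have hA (f : C) := commute_addEnd_scalarEnd A f
  have hBG : Commute (addEnd B) (addEnd G) := by
    change addEnd (B * G) = addEnd (G * B)
    congr 1
    exact (((Commute.refl A).sub_left (Algebra.commute_algebraMap_left _ _)).sub_right
      (Algebra.commute_algebraMap_right _ _)).eq
  have eB : addEnd B = addEnd A - scalarEnd V μ := rfl
  have eG : addEnd G = addEnd A - scalarEnd V ν := rfl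
  set u := postOp (addEnd A) - fstOp (addEnd A) with hu
  set v := postOp (scalarEnd V μ) - fstOp (scalarEnd V μ) with hv
  set u' := postOp (addEnd A) - sndOp (addEnd A) with hu'
  set v' := postOp (scalarEnd V ν) - sndOp (scalarEnd V ν) with hv'
  have huv : Commute u v :=
    ((commute_postOp (hA μ)).sub_right (commute_postOp_fstOp _ _)).sub_left
      ((commute_postOp_fstOp _ _).symm.sub_right (commute_fstOp (hA μ)))
  have huv' : Commute u' v' :=
    ((commute_postOp (hA ν)).sub_right (commute_postOp_sndOp _ _)).sub_left
      ((commute_postOp_sndOp _ _).symm.sub_right (commute_sndOp (hA ν)))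
  have hα : postOp (addEnd B) - fstOp (addEnd B) = u - v := by
    rw [eB, postOp_sub, fstOp_sub, hu, hv]; abel
  have hγ : postOp (addEnd G) - sndOp (addEnd G) = u' - v' := by
    rw [eG, postOp_sub, sndOp_sub, hu', hv']; abel
  -- The defect of `Φ` from linearity is the derivation term. It commutes with `A` and with scalars
  -- in the vector it carries, so both `u` and `v` annihilate it; likewise in the second slot.
  have hvΦ (X Y : V) : v Φ X Y = D Y μ X := by
    change μ • Φ X Y - Φ (μ • X) Y = _
    rw [hleft]; abel
  have hvΦ' (X Y : V) : v' Φ X Y = - D X ν Y := by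
    change ν • Φ X Y - Φ X (ν • Y) = _
    rw [hright]; abel
  have z1 : u (v Φ) = 0 := AddMonoidHom.ext fun X => AddMonoidHom.ext fun Y => by
    change A (v Φ X Y) - v Φ (A X) Y = 0
    rw [hvΦ, hvΦ, hDA, sub_self]
  have z2 : v (v Φ) = 0 := AddMonoidHom.ext fun X => AddMonoidHom.ext fun Y => by
    change μ • (v Φ X Y) - v Φ (μ • X) Y = 0
    rw [hvΦ, hvΦ, hDC, sub_self]
  have z1' : u' (v' Φ) = 0 := AddMonoidHom.ext fun X => AddMonoidHom.ext fun Y => by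
    change A (v' Φ X Y) - v' Φ X (A Y) = 0
    rw [hvΦ', hvΦ', map_neg, hDA, sub_self]
  have z2' : v' (v' Φ) = 0 := AddMonoidHom.ext fun X => AddMonoidHom.ext fun Y => by
    change ν • (v' Φ X Y) - v' Φ X (ν • Y) = 0
    rw [hvΦ', hvΦ', smul_neg, hDC, sub_self]
  have hvu' : Commute (u - v) u' := by
    refine (commute_torsionOp_factors _).sub_left ?_
    exact ((commute_postOp (hA μ).symm).sub_right (commute_postOp_sndOp _ _)).sub_left
      ((commute_postOp_fstOp _ _).symm.sub_right (commute_fstOp_sndOp _ _))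
  -- The two shifts are removed one slot at a time, commuting the factors so that the one being
  -- simplified acts directly on `Φ`.
  have key : ((u - v) ^ m * (u' - v') ^ m) Φ = 0 := by
    change ((u - v) ^ m) (((u' - v') ^ m) Φ) = 0
    rw [sub_pow_apply_eq_of_sq huv' z1' z2' hm]
    change ((u - v) ^ m * u' ^ m) Φ = 0
    rw [(hvu'.pow_pow m m).eq]
    change (u' ^ m) (((u - v) ^ m) Φ) = 0
    rw [sub_pow_apply_eq_of_sq huv z1 z2 hm]
    change (u' ^ m * u ^ m) Φ = 0
    rw [← ((commute_torsionOp_factors (addEnd A)).pow_pow m m).eq]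
    exact htors
  obtain ⟨K, p, q, r, h⟩ := exists_pow_mul_eq_of_commute
    (commute_postOp_fstOp (addEnd B) (addEnd B)) (commute_postOp hBG)
    (commute_postOp_sndOp (addEnd B) (addEnd G)) (commute_postOp_fstOp (addEnd G) (addEnd B)).symm
    (commute_fstOp_sndOp (addEnd B) (addEnd G)) (commute_postOp_sndOp (addEnd G) (addEnd G)) m N
  refine ⟨K, ?_⟩
  rw [hα, hγ] at h
  have h2 := DFunLike.congr_fun (DFunLike.congr_fun (DFunLike.congr_fun h Φ) X) Y
  have e1 : (postOp (addEnd B) * postOp (addEnd G)) ^ K = postOp (addEnd (B * G)) ^ K := rfl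
  rw [e1, postOp_pow_apply, addEnd_pow_apply] at h2
  rw [h2]
  -- The slot powers stand leftmost in their products, so they replace `X` by `B ^ N X = 0` and `Y`
  -- by `G ^ N Y = 0`, whatever `q` and `r` are.
  change p (((u - v) ^ m * (u' - v') ^ m) Φ) X Y + (fstOp (addEnd B) ^ N) (q Φ) X Y
    + (sndOp (addEnd G) ^ N) (r Φ) X Y = 0
  rw [key, fstOp_pow_apply, sndOp_pow_apply, addEnd_pow_apply, addEnd_pow_apply, hX, hY]
  simp

lemma isCoprime_prod_X_sub_C_pow {ι : Type*} {μ : ι → C} {i : ι} {S : Finset ι}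
    (hμ : ∀ j ∈ S, IsUnit (μ i - μ j)) (n : ℕ) :
    IsCoprime ((Polynomial.X - Polynomial.C (μ i)) ^ n)
      (∏ j ∈ S, (Polynomial.X - Polynomial.C (μ j)) ^ n) :=
  IsCoprime.prod_right fun j hj =>
    (Polynomial.isCoprime_X_sub_C_of_isUnit_sub (hμ j hj)).pow

/-- A vector annihilated by a product of powers of `A - μ i` is a sum of vectors annihilated by
the individual powers, if the differences `μ i - μ j` are invertible. -/
lemma exists_sum_of_prod_apply_eq_zero {ι : Type*} (A : Module.End C V) (μ : ι → C)
    (S : Finset ι) (hμ : ∀ i ∈ S, ∀ j ∈ S, i ≠ j → IsUnit (μ i - μ j)) (n : ℕ) {X : V}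
    (hX : Polynomial.aeval A (∏ j ∈ S, (Polynomial.X - Polynomial.C (μ j)) ^ n) X = 0) :
    ∃ Z : ι → V, (∀ i ∈ S, ((A - algebraMap C _ (μ i)) ^ n) (Z i) = 0) ∧ X = ∑ i ∈ S, Z i := by
  classical
  induction S using Finset.induction_on generalizing X with
  | empty => exact ⟨fun _ => 0, by simp, by simpa using hX⟩
  | @insert i S hi ih =>
    rw [Finset.prod_insert hi] at hX
    have hco := isCoprime_prod_X_sub_C_pow (S := S) (fun j hj => hμ i (by simp) j (by simp [hj])
      (by rintro rfl; exact hi hj)) n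
    -- Bézout over the function ring: the unit differences make the factors coprime, so the
    -- components lie in the same module (in the application, they are smooth fields).
    have hmem := (Polynomial.sup_ker_aeval_eq_ker_aeval_mul_of_coprime A hco).ge
      (LinearMap.mem_ker.2 hX)
    obtain ⟨X₁, h1, X₂, h2, rfl⟩ := Submodule.mem_sup.1 hmem
    obtain ⟨Z, hZ, rfl⟩ := ih (fun a ha b hb => hμ a (by simp [ha]) b (by simp [hb]))
      (LinearMap.mem_ker.1 h2)
    have hne : ∀ j ∈ S, j ≠ i := by rintro j hj rfl; exact hi hj
    refine ⟨Function.update Z i X₁, ?_, ?_⟩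
    · intro j hj
      rcases Finset.mem_insert.1 hj with rfl | hj
      · simpa using h1
      · rw [Function.update_of_ne (hne j hj)]; exact hZ j hj
    · rw [Finset.sum_insert hi, Function.update_self]
      congr 1
      exact Finset.sum_congr rfl fun j hj => by rw [Function.update_of_ne (hne j hj)]

end Leibniz

/-! ### A smooth inverse function theorem on a neighbourhood. -/

section InverseFunction

variable {X Y : Type*} [NormedAddCommGroup X] [NormedSpace ℝ X] [CompleteSpace X]
  [NormedAddCommGroup Y] [NormedSpace ℝ Y]

/-- Inverse function theorem, for maps that are `C^∞` near a point: the local inverse is `C^∞` on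
a neighbourhood, and the domain may be taken inside any prescribed neighbourhood. -/
lemma exists_openPartialHomeomorph_of_contDiffAt {G : X → Y} {a : X}
    (hG : ∀ᶠ x in 𝓝 a, ContDiffAt ℝ ∞ G x) {G' : X ≃L[ℝ] Y}
    (hG' : HasFDerivAt G (G' : X →L[ℝ] Y) a) {P : X → Prop} (hP : ∀ᶠ x in 𝓝 a, P x) :
    ∃ e : OpenPartialHomeomorph X Y, a ∈ e.source ∧ (∀ x, e x = G x) ∧
      (∀ x ∈ e.source, P x) ∧ (∀ x ∈ e.source, ContDiffAt ℝ ∞ G x) ∧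
      (∀ x ∈ e.source, ∃ L : X ≃L[ℝ] Y, HasFDerivAt G (L : X →L[ℝ] Y) x ∧
        HasFDerivAt e.symm (L.symm : Y →L[ℝ] X) (e x)) ∧
      ∀ y ∈ e.target, ContDiffAt ℝ ∞ e.symm y := by
  have hn : (∞ : WithTop ℕ∞) ≠ 0 := by simp
  have ha : ContDiffAt ℝ ∞ G a := hG.self_of_nhds
  have hinv : ∀ᶠ x in 𝓝 a, fderiv ℝ G x ∈ range ((↑) : (X ≃L[ℝ] Y) → X →L[ℝ] Y) := by
    have hc : ContinuousAt (fderiv ℝ G) a :=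
      (ha.fderiv_right (m := 0) (by simp)).continuousAt
    refine hc.eventually_mem (ContinuousLinearEquiv.isOpen.mem_nhds ?_)
    rw [hG'.fderiv]; exact mem_range_self _
  obtain ⟨s, hs, hso, has⟩ := eventually_nhds_iff.1 ((hG.and hP).and hinv)
  let e₀ := ha.toOpenPartialHomeomorph G hG' hn
  let e := e₀.restrOpen s hso
  have hsrc : ∀ x ∈ e.source, x ∈ s := fun x hx => hx.2
  have hL : ∀ x ∈ e.source, ∃ L : X ≃L[ℝ] Y, HasFDerivAt G (L : X →L[ℝ] Y) x := by
    intro x hx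
    obtain ⟨L, hL⟩ := (hs x (hsrc x hx)).2
    refine ⟨L, ?_⟩
    rw [hL]
    exact ((hs x (hsrc x hx)).1.1.differentiableAt hn).hasFDerivAt
  refine ⟨e, ⟨ha.mem_toOpenPartialHomeomorph_source hG' hn, has⟩, fun x => rfl,
    fun x hx => (hs x (hsrc x hx)).1.2, fun x hx => (hs x (hsrc x hx)).1.1, ?_, ?_⟩
  · intro x hx
    obtain ⟨L, hL⟩ := hL x hx
    refine ⟨L, hL, e.hasFDerivAt_symm (e.map_source hx) ?_⟩
    rw [e.left_inv hx]; exact hL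
  · intro y hy
    obtain ⟨L, hL⟩ := hL _ (e.map_target hy)
    exact e.contDiffAt_symm hy hL (hs _ (hsrc _ (e.map_target hy))).1.1

end InverseFunction

/-! ### Superposition and primitive operators on spaces of continuous paths. -/

section Nemytskii

universe u

variable {K : Type*} [TopologicalSpace K] [CompactSpace K]

/-- Pointwise application of a continuous family of operators to a continuous function. -/
def pointwiseApply (K : Type*) [TopologicalSpace K] [CompactSpace K]
    (E G : Type*) [NormedAddCommGroup E] [NormedSpace ℝ E] [NormedAddCommGroup G]
    [NormedSpace ℝ G] : C(K, E →L[ℝ] G) →L[ℝ] C(K, E) →L[ℝ] C(K, G) :=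
  LinearMap.mkContinuous₂
    (LinearMap.mk₂ ℝ (fun (φ : C(K, E →L[ℝ] G)) (u : C(K, E)) =>
        (⟨fun t => φ t (u t), by fun_prop⟩ : C(K, G)))
      (fun _ _ _ => rfl) (fun _ _ _ => rfl)
      (fun φ u v => by ext t; exact map_add (φ t) _ _)
      (fun c φ u => by ext t; exact map_smul (φ t) c _)) 1
    (fun φ u => by
      rw [ContinuousMap.norm_le _ (by positivity)]
      intro t
      rw [one_mul]
      exact (φ t).le_of_opNorm_le_of_le (φ.norm_coe_le_norm t) (u.norm_coe_le_norm t))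

variable {E G : Type u} [NormedAddCommGroup E] [NormedSpace ℝ E] [NormedAddCommGroup G]
  [NormedSpace ℝ G]

lemma norm_pointwiseApply_le (φ : C(K, E →L[ℝ] G)) (u : C(K, E)) :
    ‖pointwiseApply K E G φ u‖ ≤ ‖φ‖ * ‖u‖ := by
  rw [ContinuousMap.norm_le _ (by positivity)]
  exact fun t => (φ t).le_of_opNorm_le_of_le (φ.norm_coe_le_norm t) (u.norm_coe_le_norm t)

/-- Pointwise application of a continuous bilinear map to continuous functions. -/
def pointwiseBilin {G E H : Type*} [NormedAddCommGroup G] [NormedSpace ℝ G]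
    [NormedAddCommGroup E] [NormedSpace ℝ E] [NormedAddCommGroup H] [NormedSpace ℝ H]
    (K : Type*) [TopologicalSpace K] [CompactSpace K] (b : G →L[ℝ] E →L[ℝ] H) :
    C(K, G) →L[ℝ] C(K, E) →L[ℝ] C(K, H) :=
  LinearMap.mkContinuous₂
    (LinearMap.mk₂ ℝ (fun (φ : C(K, G)) (u : C(K, E)) =>
        (⟨fun t => b (φ t) (u t), by fun_prop⟩ : C(K, H)))
      (fun φ ψ u => by ext t; simp)
      (fun c φ u => by ext t; simp)
      (fun φ u v => by ext t; exact map_add (b (φ t)) _ _)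
      (fun c φ u => by ext t; exact map_smul (b (φ t)) c _)) ‖b‖
    (fun φ u => by
      rw [ContinuousMap.norm_le _ (by positivity)]
      intro t
      exact (b (φ t)).le_of_opNorm_le_of_le
        (b.le_of_opNorm_le_of_le le_rfl (φ.norm_coe_le_norm t)) (u.norm_coe_le_norm t))

lemma norm_pointwiseBilin_le {H : Type*} [NormedAddCommGroup H] [NormedSpace ℝ H]
    (b : G →L[ℝ] E →L[ℝ] H) (φ : C(K, G)) (u : C(K, E)) :
    ‖pointwiseBilin K b φ u‖ ≤ ‖b‖ * ‖φ‖ * ‖u‖ := by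
  rw [ContinuousMap.norm_le _ (by positivity)]
  exact fun t => (b (φ t)).le_of_opNorm_le_of_le
    (b.le_of_opNorm_le_of_le le_rfl (φ.norm_coe_le_norm t)) (u.norm_coe_le_norm t)

lemma hasFDerivAt_pointwiseBilin {H D : Type*} [NormedAddCommGroup H] [NormedSpace ℝ H]
    [NormedAddCommGroup D] [NormedSpace ℝ D] (b : G →L[ℝ] E →L[ℝ] H) {f : D → C(K, G)}
    {g : D → C(K, E)} {f' : D →L[ℝ] C(K, G)} {g' : D →L[ℝ] C(K, E)} {x : D}
    (hf : HasFDerivAt f f' x) (hg : HasFDerivAt g g' x) :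
    HasFDerivAt (fun y => pointwiseBilin K b (f y) (g y))
      (pointwiseBilin K b (f x) ∘L g' + (pointwiseBilin K b).flip (g x) ∘L f') x :=
  (((pointwiseBilin K b).hasFDerivAt (x := f x)).comp x hf).clm_apply hg

lemma contDiff_pointwiseBilin {H D : Type*} [NormedAddCommGroup H] [NormedSpace ℝ H]
    [NormedAddCommGroup D] [NormedSpace ℝ D] (b : G →L[ℝ] E →L[ℝ] H) {f : D → C(K, G)}
    {g : D → C(K, E)} (hf : ContDiff ℝ ∞ f) (hg : ContDiff ℝ ∞ g) :
    ContDiff ℝ ∞ (fun y => pointwiseBilin K b (f y) (g y)) :=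
  ((pointwiseBilin K b).contDiff.comp hf).clm_apply hg

/-- The superposition operator `u ↦ g ∘ u` of a `C^1` map is differentiable. -/
lemma hasFDerivAt_comp_left (g : C(E, G)) (g' : C(E, E →L[ℝ] G))
    (hg : ∀ x, HasFDerivAt g (g' x) x) (u : C(K, E)) :
    HasFDerivAt (fun v : C(K, E) => g.comp v) (pointwiseApply K E G (g'.comp u)) u := by
  rw [hasFDerivAt_iff_isLittleO, Asymptotics.isLittleO_iff]
  intro ε hε
  have hcont : Continuous fun v : C(K, E) => g'.comp v := ContinuousMap.continuous_postcomp g'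
  obtain ⟨δ, hδ, h⟩ := (Metric.continuous_iff (α := C(K, E)) (β := C(K, E →L[ℝ] G))).1 hcont u ε hε
  filter_upwards [Metric.ball_mem_nhds u hδ] with v hv
  rw [ContinuousMap.norm_le _ (by positivity)]
  intro t
  have hb : ∀ y ∈ Metric.ball (u t) δ, ‖fderiv ℝ g y - g' (u t)‖ ≤ ε := by
    intro y hy
    rw [(hg y).fderiv]
    -- Translating `u` by a constant path turns continuity of `g' ∘ ·` at `u` into an estimate for
    -- `g'` near `u t` with `δ` independent of `t`.
    have h1 : dist (u + ContinuousMap.const K (y - u t)) u < δ := by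
      rw [dist_eq_norm, add_sub_cancel_left, ContinuousMap.norm_lt_iff _ hδ]
      intro s
      rwa [mem_ball_iff_norm] at hy
    have h2 := (ContinuousMap.dist_apply_le_dist t).trans (h _ h1).le
    simpa [dist_eq_norm] using h2
  have hvt : v t ∈ Metric.ball (u t) δ :=
    (ContinuousMap.dist_apply_le_dist t).trans_lt hv
  have := (convex_ball (u t) δ).norm_image_sub_le_of_norm_fderiv_le' (𝕜 := ℝ) (f := g)
    (fun x _ => (hg x).differentiableAt) hb (Metric.mem_ball_self hδ) hvt
  refine this.trans ?_
  gcongr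
  exact (v - u).norm_coe_le_norm t

/-- The derivative is pointwise application of the superposition operator of `fderiv ℝ g`, whose
target is `E →L[ℝ] G`. The induction therefore runs over all targets `G` in one universe. -/
lemma contDiff_comp_left_nat (n : ℕ) {E : Type u} [NormedAddCommGroup E] [NormedSpace ℝ E] :
    ∀ {G : Type u} [NormedAddCommGroup G] [NormedSpace ℝ G] (g : C(E, G)),
      ContDiff ℝ n g → ContDiff ℝ n (fun v : C(K, E) => g.comp v) := by
  induction n with
  | zero =>
    intro G _ _ g _
    exact contDiff_zero.2 (ContinuousMap.continuous_postcomp g)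
  | succ n ih =>
    intro G _ _ g hg
    have hg1 := (contDiff_succ_iff_fderiv (n := n)).1 (by exact_mod_cast hg)
    let g' : C(E, E →L[ℝ] G) := ⟨fderiv ℝ g, hg1.2.2.continuous⟩
    have hd : ∀ u : C(K, E), HasFDerivAt (fun v : C(K, E) => g.comp v)
        (pointwiseApply K E G (g'.comp u)) u :=
      hasFDerivAt_comp_left g g' (fun x => (hg1.1 x).hasFDerivAt)
    have : ContDiff ℝ ((n : WithTop ℕ∞) + 1) (fun v : C(K, E) => g.comp v) := by
      rw [contDiff_succ_iff_fderiv]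
      refine ⟨fun u => (hd u).differentiableAt, by simp, ?_⟩
      rw [show fderiv ℝ (fun v : C(K, E) => g.comp v) =
        fun u => pointwiseApply K E G (g'.comp u) from funext fun u => (hd u).fderiv]
      exact (pointwiseApply K E G).contDiff.comp (ih g' hg1.2.2)
    exact_mod_cast this

/-- The superposition operator of a `C^∞` map is `C^∞`. -/
lemma contDiff_comp_left (g : C(E, G)) (hg : ContDiff ℝ ∞ g) :
    ContDiff ℝ ∞ (fun v : C(K, E) => g.comp v) :=
  contDiff_infty.2 fun n => contDiff_comp_left_nat n g (hg.of_le (by exact_mod_cast le_top))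

end Nemytskii

section Primitive

open unitInterval

variable {E : Type*} [NormedAddCommGroup E] [NormedSpace ℝ E]

lemma continuous_comp_projIcc {G : Type*} [TopologicalSpace G] (u : C(I, G)) :
    Continuous fun s : ℝ => u (projIcc 0 1 zero_le_one s) :=
  u.continuous.comp continuous_projIcc

/-- The primitive vanishing at `0` of a continuous function on the unit interval. -/
def primitive (E : Type*) [NormedAddCommGroup E] [NormedSpace ℝ E] : C(I, E) →L[ℝ] C(I, E) :=
  LinearMap.mkContinuous
    { toFun u := ⟨fun t => ∫ s in (0 : ℝ)..t, u (projIcc 0 1 zero_le_one s),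
        (intervalIntegral.continuous_primitive
          (fun _ _ => (continuous_comp_projIcc u).intervalIntegrable _ _) 0).comp
          continuous_subtype_val⟩
      map_add' u v := by
        ext t
        exact intervalIntegral.integral_add ((continuous_comp_projIcc u).intervalIntegrable _ _)
          ((continuous_comp_projIcc v).intervalIntegrable _ _)
      map_smul' c u := by
        ext t
        exact intervalIntegral.integral_smul c _ } 1
    (fun u => by
      rw [ContinuousMap.norm_le _ (by positivity)]
      intro t
      have := intervalIntegral.norm_integral_le_of_norm_le_const (a := 0) (b := (t : ℝ))
        (f := fun s => u (projIcc 0 1 zero_le_one s)) (C := ‖u‖)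
        (fun s _ => u.norm_coe_le_norm _)
      refine this.trans ?_
      rw [sub_zero, abs_of_nonneg t.2.1, one_mul]
      exact mul_le_of_le_one_right (norm_nonneg _) t.2.2)

lemma primitive_apply (u : C(I, E)) (t : I) :
    primitive E u t = ∫ s in (0 : ℝ)..t, u (projIcc 0 1 zero_le_one s) := rfl

lemma norm_primitive_le (u : C(I, E)) : ‖primitive E u‖ ≤ ‖u‖ := by
  refine ((primitive E).le_of_opNorm_le ?_ u).trans_eq (one_mul _)
  exact LinearMap.mkContinuous_norm_le _ zero_le_one _

end Primitive

/-! ### Total differential equations with smooth dependence on the initial value. -/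

section TotalDifferential

open unitInterval

universe u

variable {E G : Type u} [NormedAddCommGroup E] [NormedSpace ℝ E] [NormedAddCommGroup G]
  [NormedSpace ℝ G]

/-- A solution of the integral equation `u(t) = z + ∫₀ᵗ β(F(u)) w`, multiplied by `t` and inserted
in `β(F(·)) k`, satisfies the expected integral equation. -/
lemma smul_apply_eq_primitive [CompleteSpace E] (β : G →L[ℝ] E →L[ℝ] E) {F : C(E, G)}
    {F' : C(E, E →L[ℝ] G)} (hF : ∀ x, HasFDerivAt F (F' x) x) {z w : E} {v : C(I, E)}
    (hv : v = ContinuousMap.const I z +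
      primitive E (pointwiseBilin I β (F.comp v) (ContinuousMap.const I w))) (k : E) (t : I) :
    (t : ℝ) • β (F (v t)) k = ∫ s in (0 : ℝ)..t, (β (F (v (projIcc 0 1 zero_le_one s))) k +
      (projIcc 0 1 zero_le_one s : ℝ) • β (F' (v (projIcc 0 1 zero_le_one s))
        (β (F (v (projIcc 0 1 zero_le_one s))) w)) k) := by
  let f : ℝ → E := fun s => β (F (v (projIcc 0 1 zero_le_one s))) w
  have hf : Continuous f :=
    continuous_comp_projIcc (pointwiseBilin I β (F.comp v) (ContinuousMap.const I w))
  -- Since `projIcc` extends the integrand constantly beyond the interval, `y` is differentiable on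
  -- all of `ℝ`, endpoints included.
  let y : ℝ → E := fun t => z + ∫ s in (0 : ℝ)..t, f s
  have hy : ∀ t, HasDerivAt y (f t) t := fun t =>
    (intervalIntegral.integral_hasDerivAt_right (hf.intervalIntegrable _ _)
      (hf.stronglyMeasurableAtFilter _ _) hf.continuousAt).const_add z
  have hyv : ∀ t : I, y t = v t := fun t => (DFunLike.congr_fun hv t).symm
  have hyc : Continuous y := continuous_iff_continuousAt.2 fun t => (hy t).continuousAt
  have hd : ∀ t : ℝ, HasDerivAt (fun t : ℝ => t • β (F (y t)) k)
      (t • β (F' (y t) (f t)) k + (1 : ℝ) • β (F (y t)) k) t := by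
    intro t
    have h1 : HasDerivAt (fun t => F (y t)) (F' (y t) (f t)) t :=
      (hF (y t)).comp_hasDerivAt t (hy t)
    have h2 : HasDerivAt (fun t => β (F (y t)) k) (β (F' (y t) (f t)) k) t := by
      simpa using (β.hasFDerivAt.comp_hasDerivAt t h1).clm_apply (hasDerivAt_const t k)
    exact (hasDerivAt_id t).smul h2
  have hc : Continuous fun t : ℝ => t • β (F' (y t) (f t)) k + (1 : ℝ) • β (F (y t)) k := by
    fun_prop
  have hint := intervalIntegral.integral_eq_sub_of_hasDerivAt (a := (0 : ℝ)) (b := (t : ℝ))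
    (fun s _ => hd s) (hc.intervalIntegrable _ _)
  rw [zero_smul, sub_zero, hyv] at hint
  rw [← hint]
  refine intervalIntegral.integral_congr fun s hs => ?_
  rw [uIcc_of_le t.2.1] at hs
  have hs1 : s ∈ Icc (0 : ℝ) 1 := ⟨hs.1, hs.2.trans t.2.2⟩
  have e : projIcc 0 1 zero_le_one s = ⟨s, hs1⟩ := projIcc_of_mem _ hs1
  have e2 : y s = v ⟨s, hs1⟩ := hyv ⟨s, hs1⟩
  have e3 : f s = β (F (v ⟨s, hs1⟩)) w := by simp only [f, e]
  simp only [e, e2, e3, one_smul]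
  abel

/-- Local solvability of `∂_w y = β(F(y))`, `y(0, z) = z`, under the integrability condition, with
smooth dependence on the initial value. -/
theorem exists_solution_total_differential [CompleteSpace E] (β : G →L[ℝ] E →L[ℝ] E) {F : E → G}
    (hF : ContDiff ℝ ∞ F) {z₀ : E}
    (hsymm : ∀ᶠ x in 𝓝 z₀, ∀ h k, β (fderiv ℝ F x (β (F x) h)) k = β (fderiv ℝ F x (β (F x) k)) h) :
    ∃ y : E × E → E, (∀ᶠ p in 𝓝 ((0, z₀) : E × E), ContDiffAt ℝ ∞ y p) ∧
      (∀ᶠ z in 𝓝 z₀, y (0, z) = z) ∧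
      ∀ᶠ p in 𝓝 ((0, z₀) : E × E), ∀ k, fderiv ℝ y p (k, 0) = β (F (y p)) k := by
  let cF : C(E, G) := ⟨F, hF.continuous⟩
  let cF' : C(E, E →L[ℝ] G) := ⟨fderiv ℝ F, hF.continuous_fderiv (by simp)⟩
  have hcF : ∀ x, HasFDerivAt cF (cF' x) x := fun x =>
    (hF.differentiable (by simp) x).hasFDerivAt
  let cst : E →L[ℝ] C(I, E) := ContinuousLinearMap.const ℝ I
  have hcst : ∀ (z : E) (t : I), cst z t = z := fun _ _ => rfl
  let N : C(I, E) → C(I, G) := fun v => cF.comp v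
  have hN : ContDiff ℝ ∞ N := contDiff_comp_left cF hF
  let R : (E × E) × C(I, E) → C(I, E) := fun q =>
    primitive E (pointwiseBilin I β (N q.2) (cst q.1.1))
  have hR : ContDiff ℝ ∞ R := by
    refine (primitive E).contDiff.comp (contDiff_pointwiseBilin β (hN.comp contDiff_snd) ?_)
    exact cst.contDiff.comp (contDiff_fst.comp contDiff_fst)
  -- The last component vanishes exactly when the path solves `v(t) = z + ∫₀ᵗ β(F(v)) w`. Carrying
  -- the parameters `(w, z)` along makes this an inverse function problem.
  let H : (E × E) × C(I, E) → (E × E) × C(I, E) := fun q => (q.1, q.2 - cst q.1.2 - R q)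
  have hH : ContDiff ℝ ∞ H := by
    refine contDiff_fst.prodMk ((contDiff_snd.sub ?_).sub hR)
    exact cst.contDiff.comp (contDiff_snd.comp contDiff_fst)
  let a : (E × E) × C(I, E) := ((0, z₀), cst z₀)
  have hRa : ∀ (z : E) (v : C(I, E)), R ((0, z), v) = 0 := by
    intro z v
    simp only [R, map_zero]
  -- the derivative at the base point is a shear
  let S : (E × E) × C(I, E) →L[ℝ] C(I, E) := fderiv ℝ R a
  -- For `w = 0` the integral term is identically zero, so its derivative in the path direction
  -- vanishes. The derivative of `H` is thus the identity minus a term depending on the parameters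
  -- only.
  have hS : ∀ v : C(I, E), S ((0, 0), v) = 0 := by
    intro v
    have h1 : HasFDerivAt (fun v : C(I, E) => R ((0, z₀), v))
        (S.comp (ContinuousLinearMap.inr ℝ (E × E) C(I, E))) (cst z₀) :=
      ((hR.differentiable (by simp) a).hasFDerivAt).comp (cst z₀)
        (hasFDerivAt_prodMk_right (𝕜 := ℝ) ((0, z₀) : E × E) (cst z₀))
    have h2 : HasFDerivAt (fun v : C(I, E) => R ((0, z₀), v)) (0 : C(I, E) →L[ℝ] C(I, E))
        (cst z₀) := by
      simp only [hRa]; exact hasFDerivAt_const _ _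
    exact DFunLike.congr_fun (h1.unique h2) v
  let fst' := ContinuousLinearMap.fst ℝ (E × E) C(I, E)
  let snd' := ContinuousLinearMap.snd ℝ (E × E) C(I, E)
  let T : (E × E) × C(I, E) →L[ℝ] C(I, E) := cst ∘L ContinuousLinearMap.snd ℝ E E ∘L fst' + S
  have hT : ∀ v : C(I, E), T ((0, 0), v) = 0 := by
    intro v
    change cst 0 + S ((0, 0), v) = 0
    rw [hS, map_zero, add_zero]
  have hT' : ∀ q : (E × E) × C(I, E), ∀ v, T (q.1, v) = T (q.1, 0) := by
    intro q v
    have : ((q.1, v) : (E × E) × C(I, E)) = (q.1, 0) + ((0, 0), v) := by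
      ext <;> simp
    rw [this, map_add, hT, add_zero]
  let G' : ((E × E) × C(I, E)) ≃L[ℝ] ((E × E) × C(I, E)) :=
    ContinuousLinearEquiv.equivOfInverse (fst'.prod (snd' - T)) (fst'.prod (snd' + T))
      (fun q => by
        ext1
        · rfl
        · change (q.2 - T q) + T (q.1, q.2 - T q) = q.2
          have h : T (q.1, q.2 - T q) = T q := (hT' q _).trans (hT' q q.2).symm
          rw [h, sub_add_cancel])
      (fun q => by
        ext1
        · rfl
        · change (q.2 + T q) - T (q.1, q.2 + T q) = q.2
          have h : T (q.1, q.2 + T q) = T q := (hT' q _).trans (hT' q q.2).symm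
          rw [h, add_sub_cancel_right])
  have hG' : HasFDerivAt H (G' : ((E × E) × C(I, E)) →L[ℝ] ((E × E) × C(I, E))) a := by
    have hRd : HasFDerivAt R S a := (hR.differentiable (by simp) a).hasFDerivAt
    have h2 : HasFDerivAt (fun q : (E × E) × C(I, E) => cst q.1.2)
        (cst ∘L ContinuousLinearMap.snd ℝ E E ∘L fst') a :=
      (cst ∘L ContinuousLinearMap.snd ℝ E E ∘L fst').hasFDerivAt
    have h3 := (hasFDerivAt_fst (𝕜 := ℝ) (p := a)).prodMk (((hasFDerivAt_snd (𝕜 := ℝ)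
      (p := a)).sub h2).sub hRd)
    refine h3.congr_fderiv ?_
    refine ContinuousLinearMap.ext fun q => ?_
    change (q.1, q.2 - cst q.1.2 - S q) = (q.1, q.2 - (cst q.1.2 + S q))
    rw [sub_sub]
  obtain ⟨e, hae, heH, -, -, -, hesymm⟩ := exists_openPartialHomeomorph_of_contDiffAt
    (Eventually.of_forall fun x => hH.contDiffAt) hG' (P := fun _ => True) (by simp)
  have hHa : H a = ((0, z₀), 0) := by
    change (((0, z₀) : E × E), cst z₀ - cst z₀ - R ((0, z₀), cst z₀)) = _
    rw [hRa]; simp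
  have hta : (((0, z₀), 0) : (E × E) × C(I, E)) ∈ e.target := by
    rw [← hHa, ← heH]; exact e.map_source hae
  let ψ : E × E → C(I, E) := fun p => (e.symm (p, 0)).2
  have hct : ContinuousAt (fun p : E × E => ((p, 0) : (E × E) × C(I, E))) (0, z₀) := by
    fun_prop
  have htgt : ∀ᶠ p in 𝓝 ((0, z₀) : E × E), (p, 0) ∈ e.target :=
    hct.eventually_mem (e.open_target.mem_nhds hta)
  have hψsm : ∀ᶠ p in 𝓝 ((0, z₀) : E × E), ContDiffAt ℝ ∞ ψ p := by
    filter_upwards [htgt] with p hp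
    exact contDiffAt_snd.comp p ((hesymm _ hp).comp p (contDiffAt_id.prodMk contDiffAt_const))
  have hψeq : ∀ᶠ p in 𝓝 ((0, z₀) : E × E), ψ p = cst p.2 + R (p, ψ p) := by
    filter_upwards [htgt] with p hp
    have h1 : H (e.symm (p, 0)) = (p, 0) := by rw [← heH]; exact e.right_inv hp
    have h2 : (e.symm (p, 0)).1 = p := congrArg Prod.fst h1
    have h3 : (e.symm (p, 0)).2 - cst (e.symm (p, 0)).1.2 - R (e.symm (p, 0)) = 0 :=
      congrArg Prod.snd h1
    have h4 : e.symm (p, 0) = (p, ψ p) := Prod.ext h2 rfl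
    rw [h4] at h3
    rw [sub_sub, sub_eq_zero] at h3
    exact h3
  have hψ0 : ψ (0, z₀) = cst z₀ := by
    change (e.symm ((0, z₀), 0)).2 = _
    rw [← hHa, ← heH, e.left_inv hae]
  have hψc : ContinuousAt ψ (0, z₀) := hψsm.self_of_nhds.continuousAt
  let N' : C(I, E) → C(I, E →L[ℝ] G) := fun v => cF'.comp v
  have hN'c : Continuous N' := ContinuousMap.continuous_postcomp cF'
  -- This quantity bounds the contraction factor of the homogeneous variational equation; it
  -- vanishes at `w = 0`.
  have hsmall : ∀ᶠ p in 𝓝 ((0, z₀) : E × E), ‖β‖ * ‖N' (ψ p)‖ * ‖p.1‖ < 1 := by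
    have hc : ContinuousAt (fun p : E × E => ‖β‖ * ‖N' (ψ p)‖ * ‖p.1‖) (0, z₀) :=
      (continuousAt_const.mul (ContinuousAt.norm (f := fun p => N' (ψ p))
        (hN'c.continuousAt.comp hψc))).mul continuousAt_fst.norm
    refine hc.eventually_lt continuousAt_const ?_
    simp
  have hstay : ∀ᶠ p in 𝓝 ((0, z₀) : E × E), ∀ t : I, ∀ h k,
      β (fderiv ℝ F (ψ p t) (β (F (ψ p t)) h)) k = β (fderiv ℝ F (ψ p t) (β (F (ψ p t)) k)) h := by
    obtain ⟨δ, hδ, h⟩ := Metric.eventually_nhds_iff.1 hsymm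
    have : ∀ᶠ p in 𝓝 ((0, z₀) : E × E), ψ p ∈ Metric.ball (cst z₀) δ := by
      refine hψc.eventually_mem ?_
      rw [hψ0]; exact Metric.ball_mem_nhds _ hδ
    filter_upwards [this] with p hp t
    exact h (lt_of_le_of_lt (ContinuousMap.dist_apply_le_dist (g := cst z₀) t) hp)
  let ev : C(I, E) →L[ℝ] E := ContinuousMap.evalCLM ℝ (1 : I)
  refine ⟨fun p => ψ p 1, ?_, ?_, ?_⟩
  · filter_upwards [hψsm] with p hp
    exact ev.contDiff.contDiffAt.comp p hp
  · have hc2 : ContinuousAt (fun z : E => ((0, z) : E × E)) z₀ := by fun_prop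
    filter_upwards [hc2.eventually hψeq] with z hz
    change ψ (0, z) = cst z + R ((0, z), ψ (0, z)) at hz
    rw [hRa, add_zero] at hz
    rw [hz]; rfl
  · filter_upwards [hψsm, hψeq, hψeq.eventually_nhds, hsmall, hstay] with p h1 h2 h3 h4 h5 k
    have hψd : HasFDerivAt ψ (fderiv ℝ ψ p) p := (h1.differentiableAt (by simp)).hasFDerivAt
    have hyd : fderiv ℝ (fun p => ψ p 1) p (k, 0) = (fderiv ℝ ψ p (k, 0)) 1 := by
      have : HasFDerivAt (fun p => ψ p 1) (ev ∘L fderiv ℝ ψ p) p :=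
        ev.hasFDerivAt.comp p hψd
      rw [this.fderiv]; rfl
    rw [hyd]
    set U := fderiv ℝ ψ p (k, 0) with hU
    -- the variational equation
    have hUeq : U = primitive E (pointwiseBilin I β (pointwiseApply I E G
        (N' (ψ p)) U) (cst p.1) + pointwiseBilin I β (N (ψ p)) (cst k)) := by
      have hNd : HasFDerivAt (fun p => N (ψ p))
          (pointwiseApply I E G (N' (ψ p)) ∘L fderiv ℝ ψ p) p :=
        (hasFDerivAt_comp_left cF cF' hcF (ψ p)).comp p hψd
      have h6 := hasFDerivAt_pointwiseBilin β hNd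
        ((cst ∘L ContinuousLinearMap.fst ℝ E E).hasFDerivAt (x := p))
      have h7 := ((primitive E).hasFDerivAt).comp p h6
      have h8 := ((cst ∘L ContinuousLinearMap.snd ℝ E E).hasFDerivAt (x := p)).add h7
      have h9 : HasFDerivAt ψ _ p := h8.congr_of_eventuallyEq h3
      have h10 := DFunLike.congr_fun (hψd.unique h9) (k, 0)
      rw [← hU] at h10
      refine h10.trans ?_
      simp only [add_apply, ContinuousLinearMap.comp_apply,
        ContinuousLinearMap.coe_fst', ContinuousLinearMap.coe_snd', map_zero, zero_add,
        ContinuousLinearMap.flip_apply, map_add]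
      rw [add_comm]
    let τ : C(I, ℝ) := ⟨fun t => (t : ℝ), continuous_subtype_val⟩
    -- Expected value of `U`: if `y` solves the total equation, the path is `t ↦ y(tw, z)`, whose
    -- derivative in `w` along `k` is `t β(F) k`.
    let V : C(I, E) := ⟨fun t => (t : ℝ) • β (F (ψ p t)) k, by
      have := hF.continuous
      fun_prop⟩
    have hV : ∀ t : I, V t = ∫ s in (0 : ℝ)..t, (β (F (ψ p (projIcc 0 1 zero_le_one s))) k +
      (projIcc 0 1 zero_le_one s : ℝ) • β (fderiv ℝ F (ψ p (projIcc 0 1 zero_le_one s))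
        (β (F (ψ p (projIcc 0 1 zero_le_one s))) p.1)) k) :=
      fun t => smul_apply_eq_primitive β (F := cF) (F' := cF') hcF h2 k t
    have hJ : U - V = primitive E (pointwiseBilin I β (pointwiseApply I E G
        (N' (ψ p)) (U - V)) (cst p.1)) := by
      have hV2 : V = primitive E (pointwiseBilin I β (pointwiseApply I E G
          (N' (ψ p)) V) (cst p.1) + pointwiseBilin I β (N (ψ p)) (cst k)) := by
        ext t
        rw [hV, primitive_apply]
        refine intervalIntegral.integral_congr fun s _ => ?_
        change _ = β (fderiv ℝ F (ψ p (projIcc 0 1 zero_le_one s))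
          ((projIcc 0 1 zero_le_one s : ℝ) • β (F (ψ p (projIcc 0 1 zero_le_one s))) k)) p.1
          + β (F (ψ p (projIcc 0 1 zero_le_one s))) k
        -- The integrability condition exchanges `w` and `k`, which makes `V` satisfy the
        -- variational equation of `U`.
        rw [h5, map_smul, map_smul, smul_apply, add_comm]
      calc U - V = _ - _ := congrArg₂ (· - ·) hUeq hV2
        _ = _ := by
          rw [← map_sub, add_sub_add_right_eq_sub, map_sub (pointwiseApply I E G _),
            map_sub (pointwiseBilin I β), sub_apply]
    have hnorm : ‖U - V‖ ≤ ‖β‖ * ‖N' (ψ p)‖ * ‖p.1‖ * ‖U - V‖ := by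
      have hc : ‖cst p.1‖ ≤ ‖p.1‖ := by
        rw [ContinuousMap.norm_le _ (norm_nonneg _)]
        exact fun t => le_rfl
      calc ‖U - V‖ = _ := congrArg norm hJ
        _ ≤ _ := (norm_primitive_le _).trans (norm_pointwiseBilin_le _ _ _)
        _ ≤ ‖β‖ * (‖N' (ψ p)‖ * ‖U - V‖) * ‖p.1‖ := by
          gcongr
          exact norm_pointwiseApply_le _ _
        _ = _ := by ring
    have hUV : U = V := by
      have h0 : ‖U - V‖ = 0 := by
        by_contra hne
        have hpos : 0 < ‖U - V‖ := lt_of_le_of_ne (norm_nonneg _) (Ne.symm hne)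
        nlinarith
      exact sub_eq_zero.1 (norm_eq_zero.1 h0)
    rw [hUV]
    change ((1 : I) : ℝ) • β (F (ψ p 1)) k = β (F (ψ p 1)) k
    rw [Icc.coe_one, one_smul]

end TotalDifferential

/-! ### The Frobenius theorem in a vector space. -/

section Frobenius

variable {E : Type*} [NormedAddCommGroup E] [NormedSpace ℝ E] [FiniteDimensional ℝ E]

/-- A map which is smooth near a point agrees near that point with a smooth map. -/
lemma exists_contDiff_eventuallyEq {G : Type*} [NormedAddCommGroup G] [NormedSpace ℝ G]
    {f : E → G} {a : E} (hf : ∀ᶠ x in 𝓝 a, ContDiffAt ℝ ∞ f x) :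
    ∃ g : E → G, ContDiff ℝ ∞ g ∧ g =ᶠ[𝓝 a] f := by
  obtain ⟨δ, hδ, h⟩ := Metric.eventually_nhds_iff_ball.1 hf
  let b : ContDiffBump a := ⟨δ / 3, δ / 2, by positivity, by linarith⟩
  refine ⟨fun x => b x • f x, contDiff_iff_contDiffAt.2 fun x => ?_, ?_⟩
  · by_cases hx : x ∈ Metric.ball a δ
    · exact b.contDiffAt.smul (h x hx)
    · have hx' : x ∉ tsupport b := by
        rw [b.tsupport_eq]
        exact fun hx' => hx (Metric.closedBall_subset_ball (by change δ / 2 < δ; linarith) hx')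
      refine (contDiffAt_const (c := (0 : G))).congr_of_eventuallyEq ?_
      filter_upwards [notMem_tsupport_iff_eventuallyEq.1 hx'] with y hy
      simp [hy]
  · filter_upwards [b.eventuallyEq_one] with x hx
    simp [hx]

/-- Frobenius theorem for a distribution given as the range of a family of operators. -/
theorem exists_flat_chart_of_range {F : E → E →L[ℝ] E} {z₀ : E}
    (hF : ∀ᶠ x in 𝓝 z₀, ContDiffAt ℝ ∞ F x) (hproj : ∀ v, F z₀ (F z₀ v) = F z₀ v)
    (hsymm : ∀ᶠ x in 𝓝 z₀, ∀ h k, fderiv ℝ F x (F x h) k = fderiv ℝ F x (F x k) h)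
    (hrank : ∀ᶠ x in 𝓝 z₀, Module.finrank ℝ (F x).range = Module.finrank ℝ (F z₀).range) :
    ∃ e : OpenPartialHomeomorph E E, z₀ ∈ e.source ∧ ContDiffOn ℝ ∞ e e.source ∧
      ContDiffOn ℝ ∞ e.symm e.target ∧
      ∀ x ∈ e.source, ∀ v, v ∈ (F x).range ↔ fderiv ℝ e x v ∈ (F z₀).range := by
  obtain ⟨F₁, hF₁, hFF⟩ := exists_contDiff_eventuallyEq hF
  set π := F z₀ with hπ
  have hF₁z : F₁ z₀ = π := hFF.self_of_nhds
  obtain ⟨y, hysm, hy0, hyd⟩ := exists_solution_total_differential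
    (ContinuousLinearMap.id ℝ (E →L[ℝ] E)) hF₁ (z₀ := z₀) (by
      filter_upwards [hsymm, hFF.eventually_nhds] with x h1 h2 h k
      have : fderiv ℝ F₁ x = fderiv ℝ F x := Filter.EventuallyEq.fderiv_eq h2
      simp only [ContinuousLinearMap.coe_id', id_eq]
      rw [this, h2.self_of_nhds]
      exact h1 h k)
  -- Thus `Θ x = y (π x, z₀ + x - π x)`: start on the slice transverse to the distribution and move
  -- along it by `π x`. Its derivative at `0` is the identity, and the flat chart is its local
  -- inverse.
  let ι : E →L[ℝ] E × E := π.prod (ContinuousLinearMap.id ℝ E - π)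
  let A : E → E × E := fun x => (0, z₀) + ι x
  have hA : ∀ x, HasFDerivAt A ι x := fun x => ι.hasFDerivAt.const_add _
  have hAsm : ContDiff ℝ ∞ A := contDiff_const.add ι.contDiff
  have hA0 : A 0 = (0, z₀) := by simp [A]
  have hAc : Tendsto A (𝓝 0) (𝓝 (0, z₀)) := by
    rw [← hA0]; exact hAsm.continuous.continuousAt
  let Θ : E → E := fun x => y (A x)
  have hΘsm : ∀ᶠ x in 𝓝 (0 : E), ContDiffAt ℝ ∞ Θ x := by
    filter_upwards [hAc.eventually hysm] with x hx
    exact hx.comp x hAsm.contDiffAt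
  have hΘ0 : Θ 0 = z₀ := by
    change y (A 0) = z₀
    rw [hA0]; exact hy0.self_of_nhds
  have hyd0 : HasFDerivAt y (fderiv ℝ y (0, z₀)) (0, z₀) :=
    (hysm.self_of_nhds.differentiableAt (by simp)).hasFDerivAt
  have hyfst : ∀ k, fderiv ℝ y (0, z₀) (k, 0) = π k := by
    intro k
    rw [hyd.self_of_nhds k, hy0.self_of_nhds, hF₁z]; rfl
  have hysnd : ∀ k, fderiv ℝ y (0, z₀) (0, k) = k := by
    intro k
    have h1 : HasFDerivAt (fun z => y (0, z))
        (fderiv ℝ y (0, z₀) ∘L ContinuousLinearMap.inr ℝ E E) z₀ :=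
      hyd0.comp z₀ (hasFDerivAt_prodMk_right (𝕜 := ℝ) (0 : E) z₀)
    have h2 : HasFDerivAt (fun z => y (0, z)) (ContinuousLinearMap.id ℝ E) z₀ :=
      (hasFDerivAt_id z₀).congr_of_eventuallyEq hy0
    exact DFunLike.congr_fun (h1.unique h2) k
  have hΘd : HasFDerivAt Θ ((ContinuousLinearEquiv.refl ℝ E : E ≃L[ℝ] E) : E →L[ℝ] E) 0 := by
    have h1 : HasFDerivAt Θ (fderiv ℝ y (0, z₀) ∘L ι) 0 := by
      have := (hA 0)
      rw [← hA0] at hyd0 ⊢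
      exact hyd0.comp 0 this
    refine h1.congr_fderiv (ContinuousLinearMap.ext fun v => ?_)
    change fderiv ℝ y (0, z₀) (π v, v - π v) = v
    have : ((π v, v - π v) : E × E) = (π v, 0) + (0, v - π v) := by simp
    rw [this, map_add, hyfst, hysnd, hproj]
    abel
  have hΘc : Tendsto Θ (𝓝 0) (𝓝 z₀) := by
    conv_rhs => rw [← hΘ0]
    exact hΘsm.self_of_nhds.continuousAt
  -- The derivative of `Θ` maps the range of `π` into that of `F`; equality of dimensions makes this
  -- onto.
  have hmap : ∀ᶠ x in 𝓝 (0 : E), (∀ k ∈ π.range, fderiv ℝ Θ x k = F (Θ x) k) ∧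
      Module.finrank ℝ (F (Θ x)).range = Module.finrank ℝ π.range := by
    filter_upwards [hAc.eventually hysm, hAc.eventually hyd, hΘc.eventually hrank,
      hΘc.eventually hFF] with x h1 h2 h3 h4
    refine ⟨?_, h3⟩
    rintro k ⟨l, rfl⟩
    have h5 : HasFDerivAt Θ (fderiv ℝ y (A x) ∘L ι) x :=
      (h1.differentiableAt (by simp)).hasFDerivAt.comp x (hA x)
    rw [h5.fderiv]
    change fderiv ℝ y (A x) (π (π l), π l - π (π l)) = F (Θ x) (π l)
    rw [hproj, sub_self, h2]
    change F₁ (Θ x) (π l) = _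
    rw [h4]
  obtain ⟨e, h0, heΘ, hP, hsm, hL, hsymmsm⟩ :=
    exists_openPartialHomeomorph_of_contDiffAt hΘsm hΘd hmap
  refine ⟨e.symm, ?_, fun x hx => (hsymmsm x hx).contDiffWithinAt, fun x hx => ?_, ?_⟩
  · rw [← hΘ0, ← heΘ]; exact e.map_source h0
  · refine ((hsm x hx).congr_of_eventuallyEq ?_).contDiffWithinAt
    exact Eventually.of_forall heΘ
  · intro x hx v
    have hxs : e.symm x ∈ e.source := e.map_target hx
    obtain ⟨L, hL1, hL2⟩ := hL _ hxs
    obtain ⟨hP1, hP2⟩ := hP _ hxs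
    have hex : e (e.symm x) = x := e.right_inv hx
    rw [hex] at hL2
    have hΘx : Θ (e.symm x) = x := by rw [← heΘ, hex]
    rw [hΘx] at hP1 hP2
    rw [hL1.fderiv] at hP1
    have hle : π.range.map (L : E →L[ℝ] E).toLinearMap ≤ (F x).range := by
      rintro _ ⟨k, hk, rfl⟩
      exact ⟨k, (hP1 k hk).symm⟩
    have hfr : Module.finrank ℝ (π.range.map (L : E →L[ℝ] E).toLinearMap) =
        Module.finrank ℝ (F x).range := by
      rw [hP2]
      exact LinearEquiv.finrank_map_eq L.toLinearEquiv _
    have heq := Submodule.eq_of_le_of_finrank_eq hle hfr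
    rw [hL2.fderiv, ← heq]
    constructor
    · rintro ⟨k, hk, rfl⟩
      simpa using hk
    · intro h
      exact ⟨_, h, by simp⟩

/-- A family of operators of constant corank has the same kernels, locally, as the ranges of a
smooth family of operators `F` with `F z₀` a projection `π`, `F x` fixing its range and
`π F x = π`. -/
lemma exists_range_eq_ker {Q : E → E →L[ℝ] E} {z₀ : E}
    (hQ : ∀ᶠ x in 𝓝 z₀, ContDiffAt ℝ ∞ Q x)
    (hrank : ∀ᶠ x in 𝓝 z₀, Module.finrank ℝ (Q x).ker = Module.finrank ℝ (Q z₀).ker) :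
    ∃ F : E → E →L[ℝ] E, (∀ v, F z₀ (F z₀ v) = F z₀ v) ∧ ∀ᶠ x in 𝓝 z₀, ContDiffAt ℝ ∞ F x ∧
      (F x).range = (Q x).ker ∧ (∀ v, F z₀ (F x v) = F z₀ v) ∧
      ∀ v ∈ (Q x).ker, F z₀ v = 0 → v = 0 := by
  obtain ⟨W', hW'⟩ := (Q z₀).ker.exists_isCompl
  let πl : E →ₗ[ℝ] E := (Q z₀).ker.subtype ∘ₗ (Q z₀).ker.projectionOnto W' hW'
  let π : E →L[ℝ] E := LinearMap.toContinuousLinearMap πl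
  have hπmem : ∀ v, π v ∈ (Q z₀).ker := fun v => ((Q z₀).ker.projectionOnto W' hW' v).2
  have hπid : ∀ v ∈ (Q z₀).ker, π v = v := fun v hv =>
    congrArg Subtype.val (Submodule.projectionOnto_apply_left hW' ⟨v, hv⟩)
  have hπcompl : ∀ v, v - π v ∈ W' := by
    intro v
    rw [← Submodule.ker_projectionOnto hW', LinearMap.mem_ker, map_sub, sub_eq_zero]
    exact (Submodule.projectionOnto_apply_left hW' _).symm
  have hπrange : π.range = (Q z₀).ker := by
    ext v
    exact ⟨by rintro ⟨w, rfl⟩; exact hπmem w, fun hv => ⟨v, hπid v hv⟩⟩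
  have hinj : LinearMap.ker ((Q z₀).toLinearMap ∘ₗ W'.subtype) = ⊥ := by
    rw [LinearMap.ker_eq_bot']
    intro w hw
    have : (w : E) ∈ (Q z₀).ker ⊓ W' := ⟨hw, w.2⟩
    rw [hW'.inf_eq_bot] at this
    exact Subtype.ext this
  obtain ⟨g, hg⟩ := LinearMap.exists_leftInverse_of_injective _ hinj
  let Z : E →L[ℝ] E := LinearMap.toContinuousLinearMap (W'.subtype ∘ₗ g)
  have hZ : ∀ v, Z (Q z₀ v) = v - π v := by
    intro v
    have h1 : Q z₀ v = Q z₀ (v - π v) := by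
      have : Q z₀ (π v) = 0 := hπmem v
      rw [map_sub, this, sub_zero]
    rw [h1]
    exact congrArg Subtype.val (DFunLike.congr_fun hg ⟨v - π v, hπcompl v⟩)
  -- As `Z` inverts `Q z₀` on the complement, `Θ z₀ = 1`, and `Θ x` equals `π` on the kernel of `Q
  -- x`. Hence `(Θ x)⁻¹ π` reproduces that kernel, which fills its range by dimension.
  let Θ : E → E →L[ℝ] E := fun x => Z * Q x + π
  have hΘ0 : Θ z₀ = 1 := by
    ext v
    change Z (Q z₀ v) + π v = v
    rw [hZ, sub_add_cancel]
  have hΘsm : ∀ᶠ x in 𝓝 z₀, ContDiffAt ℝ ∞ Θ x := by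
    filter_upwards [hQ] with x hx
    exact (contDiffAt_const.mul hx).add contDiffAt_const
  have hΘu : ∀ᶠ x in 𝓝 z₀, IsUnit (Θ x) := by
    refine hΘsm.self_of_nhds.continuousAt.eventually_mem (Units.isOpen.mem_nhds ?_)
    rw [hΘ0]; exact isUnit_one
  let F : E → E →L[ℝ] E := fun x => Ring.inverse (Θ x) * π
  have hF0 : F z₀ = π := by simp only [F, hΘ0, Ring.inverse_one, one_mul]
  refine ⟨F, fun v => by rw [hF0]; exact hπid _ (hπmem v), ?_⟩
  filter_upwards [hΘsm, hΘu, hrank] with x h1 h2 h3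
  obtain ⟨u, hu⟩ := h2
  have hFx : F x = ↑u⁻¹ * π := by simp only [F, ← hu, Ring.inverse_unit]
  have huu : ∀ v, (u : E →L[ℝ] E) ((↑u⁻¹ : E →L[ℝ] E) v) = v := fun v =>
    DFunLike.congr_fun u.mul_inv v
  have huu' : ∀ v, (↑u⁻¹ : E →L[ℝ] E) ((u : E →L[ℝ] E) v) = v := fun v =>
    DFunLike.congr_fun u.inv_mul v
  have hker : ∀ v ∈ (Q x).ker, (u : E →L[ℝ] E) v = π v := by
    intro v hv
    rw [hu]
    change Z (Q x v) + π v = π v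
    rw [show Q x v = 0 from hv, map_zero, zero_add]
  have hle : (Q x).ker ≤ (F x).range := by
    intro v hv
    refine ⟨v, ?_⟩
    rw [hFx]
    change (↑u⁻¹ : E →L[ℝ] E) (π v) = v
    rw [← hker v hv, huu']
  have hfr : Module.finrank ℝ (F x).range ≤ Module.finrank ℝ (Q x).ker := by
    rw [h3, ← hπrange, hFx]
    change Module.finrank ℝ (LinearMap.range ((↑u⁻¹ : E →L[ℝ] E).toLinearMap ∘ₗ π.toLinearMap)) ≤ _
    rw [LinearMap.range_comp]
    exact Submodule.finrank_map_le _ _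
  have heq := Submodule.eq_of_le_of_finrank_le hle hfr
  refine ⟨?_, heq.symm, ?_, ?_⟩
  · have : ContDiffAt ℝ ∞ (fun x => Ring.inverse (Θ x)) x := by
      have hi := contDiffAt_ringInverse ℝ (n := ∞) u
      rw [hu] at hi
      exact hi.comp x h1
    exact this.mul contDiffAt_const
  · intro v
    rw [hF0]
    have : F x v ∈ (Q x).ker := by rw [heq]; exact ⟨v, rfl⟩
    rw [← hker _ this, hFx]
    exact huu _
  · intro v hv h0
    rw [hF0] at h0
    rw [← huu' v, hker v hv, h0, map_zero]

/-- Frobenius theorem for a distribution given as the kernel of a family of operators. -/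
theorem exists_flat_chart_of_ker {Q : E → E →L[ℝ] E} {z₀ : E}
    (hQ : ∀ᶠ x in 𝓝 z₀, ContDiffAt ℝ ∞ Q x)
    (hrank : ∀ᶠ x in 𝓝 z₀, Module.finrank ℝ (Q x).ker = Module.finrank ℝ (Q z₀).ker)
    (hinv : ∀ᶠ x in 𝓝 z₀, ∀ X Y : E → E, (∀ᶠ y in 𝓝 x, ContDiffAt ℝ ∞ X y) →
      (∀ᶠ y in 𝓝 x, ContDiffAt ℝ ∞ Y y) → (∀ᶠ y in 𝓝 x, X y ∈ (Q y).ker) →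
      (∀ᶠ y in 𝓝 x, Y y ∈ (Q y).ker) → VectorField.lieBracket ℝ X Y x ∈ (Q x).ker) :
    ∃ e : OpenPartialHomeomorph E E, z₀ ∈ e.source ∧ ContDiffOn ℝ ∞ e e.source ∧
      ContDiffOn ℝ ∞ e.symm e.target ∧ ∃ W : Submodule ℝ E,
      ∀ᶠ x in 𝓝 z₀, x ∈ e.source → ∀ v, v ∈ (Q x).ker ↔ fderiv ℝ e x v ∈ W := by
  obtain ⟨F, hFproj, hF⟩ := exists_range_eq_ker hQ hrank
  have hFF := hF.eventually_nhds
  obtain ⟨e, he0, he1, he2, he3⟩ := exists_flat_chart_of_range (F := F) (z₀ := z₀)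
    (hF.mono fun x hx => hx.1) hFproj (by
      filter_upwards [hinv, hFF] with x h1 h2 h k
      obtain ⟨hsm, hrange, -, hzero⟩ := h2.self_of_nhds
      have hd : ∀ k, HasFDerivAt (fun y => F y k) ((fderiv ℝ F x).flip k) x := fun k => by
        have := (hsm.differentiableAt (by simp)).hasFDerivAt.clm_apply
          (hasFDerivAt_const k x)
        simpa using this
      have hb := h1 (fun y => F y h) (fun y => F y k)
        (h2.mono fun y hy => hy.1.clm_apply contDiffAt_const)
        (h2.mono fun y hy => hy.1.clm_apply contDiffAt_const)
        (h2.mono fun y hy => by rw [← hy.2.1]; exact ⟨h, rfl⟩)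
        (h2.mono fun y hy => by rw [← hy.2.1]; exact ⟨k, rfl⟩)
      have hb' : VectorField.lieBracket ℝ (fun y => F y h) (fun y => F y k) x =
          fderiv ℝ F x (F x h) k - fderiv ℝ F x (F x k) h := by
        rw [VectorField.lieBracket, (hd h).fderiv, (hd k).fderiv]; rfl
      rw [hb'] at hb
      -- Since `π F` is constant, `π` kills the derivatives of `F`, hence the bracket of two fields
      -- `F h`, `F k`. By involutivity that bracket also lies in the kernel of `Q x`, on which `π`
      -- is injective; so it is zero, which is the required symmetry.
      have hπ : ∀ l k, F z₀ (fderiv ℝ F x l k) = 0 := by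
        intro l k
        have h3 : HasFDerivAt (fun y => F z₀ (F y k)) (F z₀ ∘L (fderiv ℝ F x).flip k) x :=
          (F z₀).hasFDerivAt.comp x (hd k)
        have h4 : HasFDerivAt (fun y => F z₀ (F y k)) (0 : E →L[ℝ] E) x :=
          (hasFDerivAt_const (F z₀ k) x).congr_of_eventuallyEq
            (h2.mono fun y hy => hy.2.2.1 k)
        exact DFunLike.congr_fun (h3.unique h4) l
      exact sub_eq_zero.1 (hzero _ hb (by rw [map_sub, hπ, hπ, sub_zero]))) (by
    filter_upwards [hF, hrank] with x hx hx'
    rw [hx.2.1, hx', hF.self_of_nhds.2.1])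
  refine ⟨e, he0, he1, he2, (F z₀).range, ?_⟩
  filter_upwards [hF] with x hx hxe v
  rw [← hx.2.1]
  exact he3 x hxe v

end Frobenius

/-! ### Smoothness of roots of constant multiplicity. -/

section Roots

variable {E : Type*} [NormedAddCommGroup E] [NormedSpace ℝ E] [FiniteDimensional ℝ E]

-- The coefficients are universal polynomials in the matrix entries.
open Polynomial in
lemma contDiffAt_charpoly_coeff {L : E → E →L[ℝ] E} {a : E} (hL : ContDiffAt ℝ ∞ L a) (k : ℕ) :
    ContDiffAt ℝ ∞ (fun x => (L x).toLinearMap.charpoly.coeff k) a := by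
  let b := Module.finBasis ℝ E
  have hent : ∀ p : Fin (Module.finrank ℝ E) × Fin (Module.finrank ℝ E),
      ContDiffAt ℝ ∞ (fun x => b.repr (L x (b p.2)) p.1) a := by
    intro p
    have : ContDiffAt ℝ ∞ (fun x => L x (b p.2)) a := hL.clm_apply contDiffAt_const
    exact ((b.coord p.1).toContinuousLinearMap).contDiff.contDiffAt.comp a this
  have heq : ∀ x, (L x).toLinearMap.charpoly.coeff k =
      ∑ d ∈ ((Matrix.charpoly.univ ℝ (Fin (Module.finrank ℝ E))).coeff k).support,
        ((Matrix.charpoly.univ ℝ (Fin (Module.finrank ℝ E))).coeff k).coeff d *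
          ∏ p, (b.repr (L x (b p.2)) p.1) ^ d p := by
    intro x
    rw [← LinearMap.charpoly_toMatrix _ b, ← MvPolynomial.eval_eq']
    have := Matrix.charpoly.univ_coeff_eval₂Hom (Fin (Module.finrank ℝ E)) (RingHom.id ℝ)
      (fun p => LinearMap.toMatrix b b (L x).toLinearMap p.1 p.2) k
    rw [MvPolynomial.coe_eval₂Hom, MvPolynomial.eval₂_id] at this
    simp only [LinearMap.toMatrix_apply] at this
    rw [show (LinearMap.toMatrix b b (L x).toLinearMap) = Matrix.of (Function.curry
      (fun p => b.repr (L x (b p.2)) p.1)) from by ext; simp [LinearMap.toMatrix_apply]]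
    exact this.symm
  simp only [heq]
  exact ContDiffAt.sum fun d _ => contDiffAt_const.mul (contDiffAt_prod fun p _ => (hent p).pow _)

open Polynomial in
/-- A continuous family of roots of constant multiplicity of a smooth family of polynomials is
smooth. -/
lemma contDiffAt_of_rootMultiplicity_eq {p : E → ℝ[X]} {a : E} {n r : ℕ}
    (hdeg : ∀ x, (p x).natDegree ≤ n) (hp : ∀ x, p x ≠ 0)
    (hcoeff : ∀ k, ContDiffAt ℝ ∞ (fun x => (p x).coeff k) a) {μ : E → ℝ}
    (hμ : ContinuousAt μ a) (hr : ∀ᶠ x in 𝓝 a, (p x).rootMultiplicity (μ x) = r + 1) :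
    ContDiffAt ℝ ∞ μ a := by
  -- A root of multiplicity `r + 1` is a simple root of the `r`-th derivative, so the implicit
  -- function theorem applies to `f`.
  let f : E × ℝ → ℝ := fun q => (derivative^[r] (p q.1)).eval q.2
  have hroot : ∀ᶠ x in 𝓝 a, f (x, μ x) = 0 := by
    filter_upwards [hr] with x hx
    exact (lt_rootMultiplicity_iff_isRoot_iterate_derivative (hp x)).1
      (by rw [hx]; exact Nat.lt_succ_self r) r le_rfl
  have hsimple : (derivative^[r + 1] (p a)).eval (μ a) ≠ 0 := by
    intro h
    have : r + 1 < (p a).rootMultiplicity (μ a) := by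
      refine (lt_rootMultiplicity_iff_isRoot_iterate_derivative (hp a)).2 fun m hm => ?_
      rcases hm.lt_or_eq with hm | rfl
      · exact (lt_rootMultiplicity_iff_isRoot_iterate_derivative (hp a)).1
          (by rw [hr.self_of_nhds]; exact Nat.lt_succ_self r) m (Nat.lt_succ_iff.1 hm)
      · exact h
    rw [hr.self_of_nhds] at this
    exact lt_irrefl _ this
  have hfsm : ContDiffAt ℝ ∞ f (a, μ a) := by
    have heq : f = fun q => ∑ k ∈ Finset.range (n + 1),
        (derivative^[r] (p q.1)).coeff k * q.2 ^ k := by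
      funext q
      refine eval_eq_sum_range' (Nat.lt_succ_of_le ?_) q.2
      exact (natDegree_iterate_derivative _ _).trans ((Nat.sub_le _ _).trans (hdeg _))
    rw [heq]
    refine ContDiffAt.sum fun k _ => ContDiffAt.mul ?_ (contDiffAt_snd.pow k)
    simp only [coeff_iterate_derivative, nsmul_eq_mul]
    exact contDiffAt_const.mul ((hcoeff _).comp (a, μ a) contDiffAt_fst)
  have hpart : fderiv ℝ f (a, μ a) ∘L ContinuousLinearMap.inr ℝ E ℝ =
      ((ContinuousLinearEquiv.unitsEquivAut ℝ (Units.mk0 _ hsimple) : ℝ ≃L[ℝ] ℝ) : ℝ →L[ℝ] ℝ) := by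
    have h1 : HasFDerivAt (fun t => f (a, t))
        (fderiv ℝ f (a, μ a) ∘L ContinuousLinearMap.inr ℝ E ℝ) (μ a) :=
      (hfsm.differentiableAt (by simp)).hasFDerivAt.comp (μ a)
        (hasFDerivAt_prodMk_right (𝕜 := ℝ) a (μ a))
    have h2 : HasDerivAt (fun t => f (a, t)) ((derivative^[r + 1] (p a)).eval (μ a)) (μ a) := by
      rw [Function.iterate_succ_apply']
      exact (derivative^[r] (p a)).hasDerivAt (μ a)
    rw [h1.unique h2.hasFDerivAt]
    ext
    simp
  have hinv : (fderiv ℝ f (a, μ a) ∘L ContinuousLinearMap.inr ℝ E ℝ).IsInvertible := by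
    rw [hpart]; exact ContinuousLinearMap.isInvertible_equiv
  have himp := hfsm.contDiffAt_implicitFunction (by simp) hinv
  refine himp.congr_of_eventuallyEq ?_
  -- Continuity keeps `(x, μ x)` in the neighbourhood where the implicit function is the only
  -- solution, so `μ` coincides with it.
  have hc : ContinuousAt (fun x => (x, μ x)) a := continuousAt_id.prodMk hμ
  filter_upwards [hroot, hc.eventually
    (hfsm.eventually_apply_eq_iff_implicitFunction (by simp) hinv)] with x h1 h2
  exact (h2.1 (h1.trans hroot.self_of_nhds.symm)).symm

end Roots

/-! ### Smooth vector fields as a module with bracket over the ring of smooth functions. -/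

section SmoothFields

variable (E : Type*) [NormedAddCommGroup E] [NormedSpace ℝ E]
  (M : Type*) [TopologicalSpace M] [ChartedSpace E M] [IsManifold 𝓘(ℝ, E) ∞ M]

/-- The ring of smooth functions on `M`. -/
def smoothFunctions : Subring (M → ℝ) where
  carrier := {f | ContMDiff 𝓘(ℝ, E) 𝓘(ℝ, ℝ) ∞ f}
  mul_mem' hf hg := ContMDiff.mul hf hg
  one_mem' := contMDiff_const
  add_mem' hf hg := ContMDiff.add hf hg
  zero_mem' := contMDiff_const
  neg_mem' hf := ContMDiff.neg hf

/-- The module of smooth vector fields on `M`. -/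
def smoothFields : Submodule (smoothFunctions E M) (VField E M) where
  carrier := {X | X.IsSmooth}
  add_mem' hX hY := ContMDiff.add_section hX hY
  zero_mem' := Bundle.contMDiff_zeroSection ℝ (TangentSpace 𝓘(ℝ, E) : M → Type _)
  smul_mem' f _ hX := ContMDiff.smul_section f.2 hX

/-- The type of smooth functions on `M`. -/
def SmoothFunction : Type _ := smoothFunctions E M

instance : CommRing (SmoothFunction E M) := inferInstanceAs (CommRing (smoothFunctions E M))

/-- The type of smooth vector fields on `M`. -/
def SmoothField : Type _ := smoothFields E M

instance : AddCommGroup (SmoothField E M) := inferInstanceAs (AddCommGroup (smoothFields E M))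

instance : Module (SmoothFunction E M) (SmoothField E M) :=
  inferInstanceAs (Module (smoothFunctions E M) (smoothFields E M))

variable {E M}

lemma VField.IsSmooth.mlieBracket [CompleteSpace E] {X Y : VField E M} (hX : X.IsSmooth)
    (hY : Y.IsSmooth) : VField.IsSmooth (VectorField.mlieBracket 𝓘(ℝ, E) X Y) := by
  have : IsManifold 𝓘(ℝ, E) ((⊤ : ℕ∞) + 1 : WithTop ℕ∞) M :=
    inferInstanceAs (IsManifold 𝓘(ℝ, E) ∞ M)
  have : IsManifold 𝓘(ℝ, E) (minSmoothness ℝ 2) M := by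
    rw [minSmoothness_of_isRCLikeNormedField]; infer_instance
  have : IsManifold 𝓘(ℝ, E) (minSmoothness ℝ 3) M := by
    rw [minSmoothness_of_isRCLikeNormedField]; infer_instance
  exact ContDiff.mlieBracket_vectorField (m := ⊤) (n := ⊤) hX hY (by simp)

lemma VField.IsSmooth.mdifferentiableAt {X : VField E M} (hX : X.IsSmooth) (x : M) :
    MDifferentiableAt 𝓘(ℝ, E) (𝓘(ℝ, E).prod 𝓘(ℝ, E))
      (fun x : M => Bundle.TotalSpace.mk' E (E := (TangentSpace 𝓘(ℝ, E) : M → Type _)) x (X x)) x :=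
  (hX x).mdifferentiableAt (by simp)

lemma OpField.IsSmooth.app {A : OpField E M} (hA : A.IsSmooth) {X : VField E M}
    (hX : X.IsSmooth) : (A.app X).IsSmooth :=
  fun x => ContMDiffAt.clm_bundle_apply (hA x) (hX x)

/-- The Lie bracket of smooth vector fields. -/
def fieldBracket [CompleteSpace E] : SmoothField E M →+ SmoothField E M →+ SmoothField E M :=
  AddMonoidHom.mk' (fun X => AddMonoidHom.mk'
    (fun Y => ⟨VectorField.mlieBracket 𝓘(ℝ, E) X.1 Y.1, VField.IsSmooth.mlieBracket X.2 Y.2⟩)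
    (fun Y Z => Subtype.ext <| funext fun x => VectorField.mlieBracket_add_right
      (VField.IsSmooth.mdifferentiableAt Y.2 x) (VField.IsSmooth.mdifferentiableAt Z.2 x)))
    (fun X Y => AddMonoidHom.ext fun _ => Subtype.ext <| funext fun x =>
      VectorField.mlieBracket_add_left
        (VField.IsSmooth.mdifferentiableAt X.2 x) (VField.IsSmooth.mdifferentiableAt Y.2 x))

/-- The endomorphism of the module of smooth vector fields induced by a smooth operator field. -/
def fieldEnd (A : OpField E M) (hA : A.IsSmooth) :
    Module.End (SmoothFunction E M) (SmoothField E M) where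
  toFun X := ⟨A.app X.1, hA.app X.2⟩
  map_add' X Y := Subtype.ext <| funext fun x => (A x).map_add (X.1 x) (Y.1 x)
  map_smul' f X := Subtype.ext <| funext fun x => (A x).map_smul (f.1 x) (X.1 x)

lemma fieldEnd_apply (A : OpField E M) (hA : A.IsSmooth) (X : SmoothField E M) (x : M) :
    (fieldEnd A hA X).1 x = A x (X.1 x) := rfl

lemma torsionOp_fieldBracket [CompleteSpace E] (A : OpField E M) (hA : A.IsSmooth) (m : ℕ)
    (X Y : SmoothField E M) :
    (torsionOp (addEnd (fieldEnd A hA)) m fieldBracket X Y).1 = torsion A m X.1 Y.1 := by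
  induction m generalizing X Y with
  | zero => rw [torsionOp_zero_apply]; rfl
  | succ m ih =>
    rw [torsionOp_succ_apply]
    have h1 := ih X Y
    have h2 := ih (fieldEnd A hA X) (fieldEnd A hA Y)
    have h3 := ih X (fieldEnd A hA Y)
    have h4 := ih (fieldEnd A hA X) Y
    change A.app (A.app (torsionOp (addEnd (fieldEnd A hA)) m fieldBracket X Y).1) +
      (torsionOp (addEnd (fieldEnd A hA)) m fieldBracket (fieldEnd A hA X) (fieldEnd A hA Y)).1 -
      A.app ((torsionOp (addEnd (fieldEnd A hA)) m fieldBracket X (fieldEnd A hA Y)).1 +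
        (torsionOp (addEnd (fieldEnd A hA)) m fieldBracket (fieldEnd A hA X) Y).1) = _
    rw [h1, h2, h3, h4]
    rfl

/-- The derivation term in the Leibniz rule of the Lie bracket. -/
def leibnizTerm [CompleteSpace E] (X : SmoothField E M) (f : SmoothFunction E M)
    (Y : SmoothField E M) : SmoothField E M :=
  fieldBracket X (f • Y) - f • fieldBracket X Y

/-- The value `X(f) Y` is tensorial in `Y`; this gives the commutation with operators and with
scalars used in the algebraic part. -/
lemma leibnizTerm_apply [CompleteSpace E] (X : SmoothField E M) (f : SmoothFunction E M)
    (Y : SmoothField E M) (x : M) :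
    (leibnizTerm X f Y).1 x = mvfderiv 𝓘(ℝ, E) f.1 x (X.1 x) • Y.1 x := by
  have hf : ContMDiff 𝓘(ℝ, E) 𝓘(ℝ, ℝ) ∞ f.1 := f.2
  change VectorField.mlieBracket 𝓘(ℝ, E) X.1 (f.1 • Y.1) x
    - f.1 x • VectorField.mlieBracket 𝓘(ℝ, E) X.1 Y.1 x = _
  rw [VectorField.mlieBracket_smul_right ((hf x).mdifferentiableAt (by simp))
    (VField.IsSmooth.mdifferentiableAt Y.2 x), add_sub_cancel_right]

lemma fieldBracket_smul_left [CompleteSpace E] (f : SmoothFunction E M)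
    (X Y : SmoothField E M) :
    fieldBracket (f • X) Y = f • fieldBracket X Y - leibnizTerm Y f X := by
  have h (X Y : SmoothField E M) : fieldBracket X Y = - fieldBracket Y X :=
    Subtype.ext <| funext fun x => VectorField.mlieBracket_swap_apply
  rw [leibnizTerm, h (f • X), h X, smul_neg]
  abel

lemma fieldEnd_leibnizTerm [CompleteSpace E] (A : OpField E M) (hA : A.IsSmooth)
    (X : SmoothField E M) (f : SmoothFunction E M) (Y : SmoothField E M) :
    fieldEnd A hA (leibnizTerm X f Y) = leibnizTerm X f (fieldEnd A hA Y) :=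
  Subtype.ext <| funext fun x => by
    rw [leibnizTerm_apply, fieldEnd_apply, leibnizTerm_apply, map_smul]; rfl

lemma smul_leibnizTerm [CompleteSpace E] (X : SmoothField E M) (f g : SmoothFunction E M)
    (Y : SmoothField E M) : g • leibnizTerm X f Y = leibnizTerm X f (g • Y) :=
  Subtype.ext <| funext fun x => by
    rw [leibnizTerm_apply]
    change g.1 x • (leibnizTerm X f Y).1 x = _ • (g.1 x • Y.1 x)
    rw [leibnizTerm_apply, smul_comm]

/-- Evaluation at a point, as a ring homomorphism on smooth functions. -/
def evalAt (x : M) : SmoothFunction E M →+* ℝ :=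
  (Pi.evalRingHom (fun _ : M => ℝ) x).comp (smoothFunctions E M).subtype

/-- Passage between polynomial identities over the function ring and linear algebra in each tangent
space. -/
lemma aeval_fieldEnd_apply (A : OpField E M) (hA : A.IsSmooth)
    (p : Polynomial (SmoothFunction E M)) (X : SmoothField E M) (x : M) :
    (Polynomial.aeval (fieldEnd A hA) p X).1 x =
      Polynomial.aeval (A x).toLinearMap (p.map (evalAt x)) (X.1 x) := by
  induction p using Polynomial.induction_on' generalizing X with
  | add p q hp hq =>
    rw [map_add, Polynomial.map_add, map_add, LinearMap.add_apply, LinearMap.add_apply, ← hp, ← hq]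
    rfl
  | monomial n f =>
    rw [Polynomial.map_monomial, Polynomial.aeval_monomial, Polynomial.aeval_monomial]
    have hpow : ∀ n, ((fieldEnd A hA ^ n) X).1 x = ((A x).toLinearMap ^ n) (X.1 x) := by
      intro n
      induction n with
      | zero => rfl
      | succ n ih =>
        rw [pow_succ', pow_succ']
        change A x (((fieldEnd A hA ^ n) X).1 x) = A x _
        rw [ih]
    change f.1 x • ((fieldEnd A hA ^ n) X).1 x = f.1 x • ((A x).toLinearMap ^ n) (X.1 x)
    rw [hpow]

end SmoothFields

/-! ### Sums of generalized eigenspaces as kernels of polynomials. -/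

section GeneralizedEigenspaces

open Polynomial Module

variable {V : Type*} [AddCommGroup V] [Module ℝ V]

lemma ker_aeval_X_sub_C_pow_le (f : End ℝ V) (c : ℝ) (k : ℕ) :
    LinearMap.ker (aeval f ((X - C c) ^ k)) ≤ f.maxGenEigenspace c := by
  intro v hv
  rw [End.mem_maxGenEigenspace]
  refine ⟨k, ?_⟩
  simpa [Algebra.algebraMap_eq_smul_one] using hv

lemma ker_aeval_X_sub_C_pow_finrank [FiniteDimensional ℝ V] (f : End ℝ V) (c : ℝ) :
    LinearMap.ker (aeval f ((X - C c) ^ finrank ℝ V)) = f.maxGenEigenspace c := by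
  refine le_antisymm (ker_aeval_X_sub_C_pow_le f c _) ?_
  rw [End.maxGenEigenspace_eq_genEigenspace_finrank]
  intro v hv
  rw [End.mem_genEigenspace_nat] at hv
  simpa [Algebra.algebraMap_eq_smul_one] using hv

/-- Powers of distinct linear factors are coprime, and the dimension is an exponent large enough for
every eigenvalue. No Riesz index enters, so the operator varies smoothly with `f` and `c`. -/
lemma iSup_maxGenEigenspace_eq_ker [FiniteDimensional ℝ V] (f : End ℝ V) {ι : Type*} {c : ι → ℝ}
    (hc : Function.Injective c) (S : Finset ι) :
    ⨆ i ∈ S, f.maxGenEigenspace (c i) =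
      LinearMap.ker (aeval f (∏ i ∈ S, (X - C (c i)) ^ finrank ℝ V)) := by
  classical
  induction S using Finset.induction_on with
  | empty =>
    simp only [Finset.notMem_empty, iSup_false, iSup_bot, Finset.prod_empty, map_one]
    exact LinearMap.ker_id.symm
  | @insert i S hi ih =>
    rw [Finset.iSup_insert, ih, Finset.prod_insert hi, ← ker_aeval_X_sub_C_pow_finrank]
    refine sup_ker_aeval_eq_ker_aeval_mul_of_coprime f (isCoprime_prod_X_sub_C_pow ?_ _)
    intro j hj
    refine (sub_ne_zero.2 fun h => ?_).isUnit
    rw [hc h] at hi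
    exact hi hj

lemma finrank_iSup_maxGenEigenspace [FiniteDimensional ℝ V] (f : End ℝ V) {ι : Type*} {c : ι → ℝ}
    (hc : Function.Injective c) (S : Finset ι) :
    finrank ℝ ↥(⨆ i ∈ S, f.maxGenEigenspace (c i)) =
      ∑ i ∈ S, finrank ℝ (f.maxGenEigenspace (c i)) := by
  classical
  have hind : iSupIndep fun i => f.maxGenEigenspace (c i) := f.independent_maxGenEigenspace.comp hc
  induction S using Finset.induction_on with
  | empty => simp
  | @insert i S hi ih =>
    rw [Finset.iSup_insert, Finset.sum_insert hi, ← ih]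
    have hd : Disjoint (f.maxGenEigenspace (c i)) (⨆ j ∈ S, f.maxGenEigenspace (c j)) :=
      (hind i).mono_right (biSup_mono fun j hj => by rintro rfl; exact hi hj)
    have := Submodule.finrank_sup_add_finrank_inf_eq (f.maxGenEigenspace (c i))
      (⨆ j ∈ S, f.maxGenEigenspace (c j))
    rwa [hd.eq_bot, finrank_bot, add_zero] at this

lemma map_aeval_of_intertwine {W : Type*} [NormedAddCommGroup W] [NormedSpace ℝ W]
    {f : End ℝ V} {g : W →L[ℝ] W} (e : V →ₗ[ℝ] W) (h : ∀ v, e (f v) = g (e v)) (p : ℝ[X]) (v : V) :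
    e (aeval f p v) = aeval g p (e v) := by
  induction p using Polynomial.induction_on' generalizing v with
  | add p q hp hq => simp [hp, hq]
  | monomial n c =>
    have hpow : ∀ n, e ((f ^ n) v) = (g ^ n) (e v) := by
      intro n
      induction n with
      | zero => rfl
      | succ n ih =>
        rw [pow_succ', pow_succ']
        change e (f ((f ^ n) v)) = g ((g ^ n) (e v))
        rw [h, ih]
    simp [aeval_monomial, Algebra.algebraMap_eq_smul_one, hpow]

lemma contDiffAt_aeval_prod {E : Type*} [NormedAddCommGroup E] [NormedSpace ℝ E] {W : Type*}
    [NormedAddCommGroup W] [NormedSpace ℝ W] {ι : Type*} {L : E → W →L[ℝ] W} {c : ι → E → ℝ}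
    {a : E} (hL : ContDiffAt ℝ ∞ L a) (hc : ∀ i, ContDiffAt ℝ ∞ (c i) a) (n : ℕ) (S : Finset ι) :
    ContDiffAt ℝ ∞ (fun x => aeval (L x) (∏ i ∈ S, (X - C (c i x)) ^ n)) a := by
  classical
  induction S using Finset.induction_on with
  | empty => simpa using contDiffAt_const
  | @insert i S hi ih =>
    simp only [Finset.prod_insert hi, map_mul, map_pow, map_sub, aeval_X, aeval_C]
    have h1 : ContDiffAt ℝ ∞ (fun x => L x - algebraMap ℝ (W →L[ℝ] W) (c i x)) a := by
      simp only [Algebra.algebraMap_eq_smul_one]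
      exact hL.sub ((hc i).smul contDiffAt_const)
    have h2 : ∀ k, ContDiffAt ℝ ∞ (fun x => (L x - algebraMap ℝ (W →L[ℝ] W) (c i x)) ^ k) a := by
      intro k
      induction k with
      | zero => simpa using contDiffAt_const
      | succ k ihk => simp only [pow_succ]; exact ihk.mul h1
    exact (h2 n).mul ih

end GeneralizedEigenspaces

/-! ### Involutivity of the sums of generalized eigen-distributions. -/

section Involutive

open Polynomial

variable {E : Type*} [NormedAddCommGroup E] [NormedSpace ℝ E] [FiniteDimensional ℝ E]
  {M : Type*} [TopologicalSpace M] [ChartedSpace E M] [IsManifold 𝓘(ℝ, E) ∞ M]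

/-- The sums of generalized eigen-distributions are involutive. -/
theorem mlieBracket_mem_iSup_eigenDistribution {A : OpField E M} (hA : A.IsSmooth) {ι : Type*}
    {eig : ι → M → ℝ} (heig : ∀ i, ContMDiff 𝓘(ℝ, E) 𝓘(ℝ, ℝ) ∞ (eig i))
    (hinj : ∀ x, Function.Injective fun i => eig i x) {m : ℕ} (hm : 1 ≤ m)
    (htors : ∀ X Y : VField E M, X.IsSmooth → Y.IsSmooth → ∀ x, torsion A m X Y x = 0)
    (S : Finset ι) {X Y : VField E M} (hX : X.IsSmooth) (hY : Y.IsSmooth)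
    (hXS : ∀ x, X x ∈ ⨆ i ∈ S, eigenDistribution A (eig i) x)
    (hYS : ∀ x, Y x ∈ ⨆ i ∈ S, eigenDistribution A (eig i) x) (x : M) :
    VectorField.mlieBracket 𝓘(ℝ, E) X Y x ∈ ⨆ i ∈ S, eigenDistribution A (eig i) x := by
  have hcomplete : CompleteSpace E := FiniteDimensional.complete ℝ E
  have hfd : ∀ x : M, FiniteDimensional ℝ (TangentSpace 𝓘(ℝ, E) x) := fun _ =>
    inferInstanceAs (FiniteDimensional ℝ E)
  let μ : ι → SmoothFunction E M := fun i => ⟨eig i, heig i⟩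
  let T := fieldEnd A hA
  let n := Module.finrank ℝ E
  have hmap : ∀ (x : M) (i : ι), evalAt x (μ i) = eig i x := fun _ _ => rfl
  have htors' : torsionOp (addEnd T) m fieldBracket = 0 :=
    AddMonoidHom.ext fun Z => AddMonoidHom.ext fun Z' => Subtype.ext <| by
      rw [torsionOp_fieldBracket]
      exact funext fun x => htors Z.1 Z'.1 Z.2 Z'.2 x
  -- The shift argument needs level at least two; vanishing at level `m` passes to level `m + 1`.
  have htors2 : torsionOp (addEnd T) (m + 1) fieldBracket = 0 :=
    AddMonoidHom.ext fun Z => AddMonoidHom.ext fun Z' => by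
      rw [torsionOp_succ_apply, htors']
      simp
  have hunit : ∀ i ∈ S, ∀ j ∈ S, i ≠ j → IsUnit (μ i - μ j) := by
    intro i _ j _ hij
    have hne : ∀ x, eig i x - eig j x ≠ 0 := fun x h => hij (hinj x (sub_eq_zero.1 h))
    have hsm : ContMDiff 𝓘(ℝ, E) 𝓘(ℝ, ℝ) ∞ fun x => (eig i x - eig j x)⁻¹ :=
      ((heig i).sub (heig j)).inv₀ hne
    exact IsUnit.of_mul_eq_one (⟨_, hsm⟩ : SmoothFunction E M)
      (Subtype.ext <| funext fun x => mul_inv_cancel₀ (hne x))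
  have hdec : ∀ Z : SmoothField E M, (∀ x, Z.1 x ∈ ⨆ i ∈ S, eigenDistribution A (eig i) x) →
      ∃ W : ι → SmoothField E M, (∀ i ∈ S, ((T - algebraMap _ _ (μ i)) ^ n) (W i) = 0) ∧
        Z = ∑ i ∈ S, W i := by
    intro Z hZ
    refine exists_sum_of_prod_apply_eq_zero T μ S hunit n (Subtype.ext <| funext fun x => ?_)
    have h := hZ x
    simp only [eigenDistribution] at h
    rw [iSup_maxGenEigenspace_eq_ker (A x).toLinearMap (hinj x), LinearMap.mem_ker] at h
    rw [aeval_fieldEnd_apply, Polynomial.map_prod]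
    simp only [Polynomial.map_pow, Polynomial.map_sub, Polynomial.map_X, Polynomial.map_C, hmap]
    exact h
  obtain ⟨W, hW, hXW⟩ := hdec ⟨X, hX⟩ hXS
  obtain ⟨W', hW', hYW⟩ := hdec ⟨Y, hY⟩ hYS
  have hbr : ∀ i ∈ S, ∀ j ∈ S,
      (fieldBracket (W i) (W' j)).1 x ∈ ⨆ i ∈ S, eigenDistribution A (eig i) x := by
    intro i hi j hj
    obtain ⟨K, hK⟩ := exists_pow_bracket_eq_zero T fieldBracket leibnizTerm
      (fieldEnd_leibnizTerm A hA) smul_leibnizTerm fieldBracket_smul_left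
      (fun f X Y => by rw [leibnizTerm, add_sub_cancel]) (by omega : 2 ≤ m + 1) htors2
      (μ i) (μ j) n (hW i hi) (hW' j hj)
    have hle : ∀ i ∈ S, eigenDistribution A (eig i) x ≤ ⨆ i ∈ S, eigenDistribution A (eig i) x :=
      fun i hi => le_biSup (fun i => eigenDistribution A (eig i) x) hi
    have hK' : (aeval (A x).toLinearMap
        (((Polynomial.X - C (eig i x)) * (Polynomial.X - C (eig j x))) ^ K))
        ((fieldBracket (W i) (W' j)).1 x) = 0 := by
      have h1 : aeval T (((Polynomial.X - C (μ i)) * (Polynomial.X - C (μ j))) ^ K)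
          (fieldBracket (W i) (W' j)) = 0 := by
        simpa using hK
      have h2 := congrFun (congrArg Subtype.val h1) x
      rw [aeval_fieldEnd_apply] at h2
      simp only [Polynomial.map_pow, Polynomial.map_mul, Polynomial.map_sub, Polynomial.map_X,
        Polynomial.map_C, hmap] at h2
      exact h2
    -- For equal indices the bracket is killed by the power `2K` of a single factor; for distinct
    -- ones coprimality splits it into two generalized eigenvectors.
    by_cases hij : i = j
    · subst hij
      rw [← sq, ← pow_mul] at hK'
      exact hle i hi (ker_aeval_X_sub_C_pow_le (A x).toLinearMap _ _ hK')
    · rw [mul_pow] at hK'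
      have hco : IsCoprime ((Polynomial.X - C (eig i x)) ^ K) ((Polynomial.X - C (eig j x)) ^ K) :=
        (isCoprime_X_sub_C_of_isUnit_sub
          (sub_ne_zero.2 fun h => hij (hinj x h)).isUnit).pow
      have h3 := (sup_ker_aeval_eq_ker_aeval_mul_of_coprime (A x).toLinearMap hco).ge hK'
      have hsup : LinearMap.ker (aeval (A x).toLinearMap ((Polynomial.X - C (eig i x)) ^ K)) ⊔
          LinearMap.ker (aeval (A x).toLinearMap ((Polynomial.X - C (eig j x)) ^ K)) ≤
          ⨆ i ∈ S, eigenDistribution A (eig i) x :=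
        sup_le ((ker_aeval_X_sub_C_pow_le (A x).toLinearMap _ _).trans (hle i hi))
          ((ker_aeval_X_sub_C_pow_le (A x).toLinearMap _ _).trans (hle j hj))
      exact hsup h3
  have hval : ∀ (F : ι → SmoothField E M) (S : Finset ι),
      (∑ i ∈ S, F i).1 x = ∑ i ∈ S, (F i).1 x := fun F S =>
    map_sum ({ toFun := fun Z => Z.1 x, map_zero' := rfl, map_add' := fun _ _ => rfl } :
      SmoothField E M →+ TangentSpace 𝓘(ℝ, E) x) F S
  change (fieldBracket ⟨X, hX⟩ ⟨Y, hY⟩).1 x ∈ _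
  rw [hXW, hYW, map_sum, hval]
  refine Submodule.sum_mem _ fun j hj => ?_
  rw [map_sum, AddMonoidHom.finsetSum_apply, hval]
  exact Submodule.sum_mem _ fun i hi => hbr i hi j hj

end Involutive

/-! ### Transfer of fields and operators between the manifold and a chart. -/

section Charts

variable {E : Type*} [NormedAddCommGroup E] [NormedSpace ℝ E]
  {M : Type*} [TopologicalSpace M] [ChartedSpace E M] {φ : OpenPartialHomeomorph M E}

lemma mdifferentiable_of_mem_maximalAtlas (hφ : φ ∈ IsManifold.maximalAtlas 𝓘(ℝ, E) ∞ M) :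
    φ.MDifferentiable 𝓘(ℝ, E) 𝓘(ℝ, E) :=
  ⟨(contMDiffOn_of_mem_maximalAtlas hφ).mdifferentiableOn (by simp),
    (contMDiffOn_symm_of_mem_maximalAtlas hφ).mdifferentiableOn (by simp)⟩

lemma isInvertible_mfderiv (hφ : φ.MDifferentiable 𝓘(ℝ, E) 𝓘(ℝ, E)) {x : M}
    (hx : x ∈ φ.source) : (mfderiv 𝓘(ℝ, E) 𝓘(ℝ, E) φ x).IsInvertible :=
  ⟨hφ.mfderiv hx, rfl⟩

lemma inverse_mfderiv_symm (hφ : φ.MDifferentiable 𝓘(ℝ, E) 𝓘(ℝ, E)) {y : E}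
    (hy : y ∈ φ.target) :
    (mfderiv 𝓘(ℝ, E) 𝓘(ℝ, E) φ.symm y).inverse = mfderiv 𝓘(ℝ, E) 𝓘(ℝ, E) φ (φ.symm y) := by
  have h1 := hφ.comp_symm_deriv hy
  have h2 := hφ.symm_comp_deriv (φ.map_target hy)
  rw [φ.right_inv hy] at h2
  exact ContinuousLinearMap.inverse_eq h2 h1

lemma inverse_mfderiv (hφ : φ.MDifferentiable 𝓘(ℝ, E) 𝓘(ℝ, E)) {y : E}
    (hy : y ∈ φ.target) :
    (mfderiv 𝓘(ℝ, E) 𝓘(ℝ, E) φ (φ.symm y)).inverse = mfderiv 𝓘(ℝ, E) 𝓘(ℝ, E) φ.symm y := by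
  have h1 := hφ.comp_symm_deriv hy
  have h2 := hφ.symm_comp_deriv (φ.map_target hy)
  rw [φ.right_inv hy] at h2
  exact ContinuousLinearMap.inverse_eq h1 h2

lemma mfderiv_mfderiv_symm_apply (hφ : φ.MDifferentiable 𝓘(ℝ, E) 𝓘(ℝ, E)) {y : E}
    (hy : y ∈ φ.target) (v : E) :
    mfderiv 𝓘(ℝ, E) 𝓘(ℝ, E) φ (φ.symm y) (mfderiv 𝓘(ℝ, E) 𝓘(ℝ, E) φ.symm y v) = v :=
  DFunLike.congr_fun (hφ.comp_symm_deriv hy) v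

lemma mfderiv_symm_mfderiv_apply (hφ : φ.MDifferentiable 𝓘(ℝ, E) 𝓘(ℝ, E)) {y : E}
    (hy : y ∈ φ.target) (v : TangentSpace 𝓘(ℝ, E) (φ.symm y)) :
    mfderiv 𝓘(ℝ, E) 𝓘(ℝ, E) φ.symm y (mfderiv 𝓘(ℝ, E) 𝓘(ℝ, E) φ (φ.symm y) v) = v := by
  have h2 := hφ.symm_comp_deriv (φ.map_target hy)
  rw [φ.right_inv hy] at h2
  exact DFunLike.congr_fun h2 v

/-- The vector field on `M` with the given coordinate expression in a chart. -/
def ofChart (φ : OpenPartialHomeomorph M E) (U : E → E) : VField E M :=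
  VectorField.mpullback 𝓘(ℝ, E) 𝓘(ℝ, E) φ (V := U)

lemma mlieBracket_eq_lieBracket (U V : ∀ x : E, TangentSpace 𝓘(ℝ, E) x) (y : E) :
    VectorField.mlieBracket 𝓘(ℝ, E) U V y = VectorField.lieBracket ℝ U V y := by
  rw [← VectorField.mlieBracketWithin_univ, VectorField.mlieBracketWithin_eq_lieBracketWithin]
  exact congrFun (VectorField.lieBracketWithin_univ (V := U) (W := V)) y

lemma mpullback_symm_apply (hφ : φ.MDifferentiable 𝓘(ℝ, E) 𝓘(ℝ, E)) (X : VField E M) {y : E}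
    (hy : y ∈ φ.target) :
    VectorField.mpullback 𝓘(ℝ, E) 𝓘(ℝ, E) φ.symm X y =
      mfderiv 𝓘(ℝ, E) 𝓘(ℝ, E) φ (φ.symm y) (X (φ.symm y)) := by
  rw [VectorField.mpullback_apply, inverse_mfderiv_symm hφ hy]
  rfl

lemma ofChart_symm_apply (hφ : φ.MDifferentiable 𝓘(ℝ, E) 𝓘(ℝ, E)) (U : E → E) {y : E}
    (hy : y ∈ φ.target) :
    ofChart φ U (φ.symm y) = mfderiv 𝓘(ℝ, E) 𝓘(ℝ, E) φ.symm y (U y) := by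
  change (mfderiv 𝓘(ℝ, E) 𝓘(ℝ, E) φ (φ.symm y)).inverse (U (φ (φ.symm y))) = _
  rw [inverse_mfderiv hφ hy, φ.right_inv hy]

lemma mpullback_symm_ofChart (hφ : φ.MDifferentiable 𝓘(ℝ, E) 𝓘(ℝ, E)) (U : E → E) {y : E}
    (hy : y ∈ φ.target) :
    VectorField.mpullback 𝓘(ℝ, E) 𝓘(ℝ, E) φ.symm (ofChart φ U) y = U y := by
  rw [mpullback_symm_apply hφ _ hy, ofChart_symm_apply hφ U hy, mfderiv_mfderiv_symm_apply hφ hy]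

/-- The coordinate expression of an operator field in a chart. -/
def chartOp (φ : OpenPartialHomeomorph M E) (A : OpField E M) (y : E) : E →L[ℝ] E :=
  (mfderiv 𝓘(ℝ, E) 𝓘(ℝ, E) φ (φ.symm y)).comp
    ((A (φ.symm y)).comp (mfderiv 𝓘(ℝ, E) 𝓘(ℝ, E) φ.symm y))

lemma mfderiv_apply_eq_chartOp (hφ : φ.MDifferentiable 𝓘(ℝ, E) 𝓘(ℝ, E)) (A : OpField E M)
    {y : E} (hy : y ∈ φ.target) (v : TangentSpace 𝓘(ℝ, E) (φ.symm y)) :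
    mfderiv 𝓘(ℝ, E) 𝓘(ℝ, E) φ (φ.symm y) (A (φ.symm y) v) =
      chartOp φ A y (mfderiv 𝓘(ℝ, E) 𝓘(ℝ, E) φ (φ.symm y) v) := by
  change _ = mfderiv 𝓘(ℝ, E) 𝓘(ℝ, E) φ (φ.symm y) (A (φ.symm y)
    (mfderiv 𝓘(ℝ, E) 𝓘(ℝ, E) φ.symm y (mfderiv 𝓘(ℝ, E) 𝓘(ℝ, E) φ (φ.symm y) v)))
  rw [mfderiv_symm_mfderiv_apply hφ hy]

/-- A chart identifies the tangent space with the model space. -/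
def chartEquiv (hφ : φ.MDifferentiable 𝓘(ℝ, E) 𝓘(ℝ, E)) {y : E} (hy : y ∈ φ.target) :
    TangentSpace 𝓘(ℝ, E) (φ.symm y) ≃ₗ[ℝ] E where
  toFun := mfderiv 𝓘(ℝ, E) 𝓘(ℝ, E) φ (φ.symm y)
  invFun := mfderiv 𝓘(ℝ, E) 𝓘(ℝ, E) φ.symm y
  map_add' := map_add _
  map_smul' := map_smul _
  left_inv := mfderiv_symm_mfderiv_apply hφ hy
  right_inv := mfderiv_mfderiv_symm_apply hφ hy

/-- Both sides are the algebraic multiplicity, as the chart conjugates the two operators. Constant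
rank thus becomes constant root multiplicity. -/
lemma finrank_maxGenEigenspace_eq_rootMultiplicity_chartOp [FiniteDimensional ℝ E]
    (hφ : φ.MDifferentiable 𝓘(ℝ, E) 𝓘(ℝ, E)) (A : OpField E M) {y : E} (hy : y ∈ φ.target)
    (c : ℝ) :
    Module.finrank ℝ (Module.End.maxGenEigenspace (A (φ.symm y)).toLinearMap c) =
      (chartOp φ A y).toLinearMap.charpoly.rootMultiplicity c := by
  have : FiniteDimensional ℝ (TangentSpace 𝓘(ℝ, E) (φ.symm y)) :=
    inferInstanceAs (FiniteDimensional ℝ E)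
  rw [LinearMap.finrank_maxGenEigenspace_eq]
  congr 1
  exact (LinearEquiv.charpoly_conj (chartEquiv hφ hy) (A (φ.symm y)).toLinearMap).symm

variable [IsManifold 𝓘(ℝ, E) ∞ M]

/-- The vector field is smooth at a point. -/
def VField.IsSmoothAt (X : VField E M) (x : M) : Prop :=
  ContMDiffAt 𝓘(ℝ, E) (𝓘(ℝ, E).prod 𝓘(ℝ, E)) ∞
    (fun x : M => Bundle.TotalSpace.mk' E (E := (TangentSpace 𝓘(ℝ, E) : M → Type _)) x (X x)) x

lemma VField.IsSmoothAt.congr_of_eventuallyEq {X Y : VField E M} {x : M} (hX : X.IsSmoothAt x)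
    (h : Y =ᶠ[𝓝 x] X) : Y.IsSmoothAt x :=
  ContMDiffAt.congr_of_eventuallyEq hX (h.mono fun y hy => by simp only [hy])

lemma VField.IsSmoothAt.app {A : OpField E M} (hA : A.IsSmooth) {X : VField E M} {x : M}
    (hX : X.IsSmoothAt x) : VField.IsSmoothAt (A.app X) x :=
  ContMDiffAt.clm_bundle_apply (hA x) hX

lemma VField.IsSmoothAt.contDiffAt_mpullback_symm [CompleteSpace E]
    (hφ : φ ∈ IsManifold.maximalAtlas 𝓘(ℝ, E) ∞ M) {X : VField E M} {y : E} (hy : y ∈ φ.target)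
    (hX : X.IsSmoothAt (φ.symm y)) :
    ContDiffAt ℝ ∞ (VectorField.mpullback 𝓘(ℝ, E) 𝓘(ℝ, E) φ.symm X : E → E) y := by
  have hd := mdifferentiable_of_mem_maximalAtlas hφ
  exact contMDiffAt_vectorSpace_iff_contDiffAt.1
    (ContMDiffAt.mpullback_vectorField_preimage (n := ∞) hX
      (contMDiffAt_symm_of_mem_maximalAtlas hφ hy) ⟨hd.symm.mfderiv hy, rfl⟩ (by simp))

lemma isSmoothAt_ofChart [CompleteSpace E] (hφ : φ ∈ IsManifold.maximalAtlas 𝓘(ℝ, E) ∞ M)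
    {U : E → E} {x : M} (hx : x ∈ φ.source) (hU : ContDiffAt ℝ ∞ U (φ x)) :
    VField.IsSmoothAt (ofChart φ U) x :=
  ContMDiffAt.mpullback_vectorField_preimage (n := ∞)
    (contMDiffAt_vectorSpace_iff_contDiffAt.2 hU) (contMDiffAt_of_mem_maximalAtlas hφ hx)
    (isInvertible_mfderiv (mdifferentiable_of_mem_maximalAtlas hφ) hx) (by simp)

/-- A locally defined smooth vector field extends to `M` after multiplication by a bump function. -/
lemma exists_isSmooth_eventuallyEq [FiniteDimensional ℝ E] [T2Space M] {X : VField E M} {x : M}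
    (hX : ∀ᶠ y in 𝓝 x, X.IsSmoothAt y) {u : Set M} (hu : u ∈ 𝓝 x) :
    ∃ Y : VField E M, Y.IsSmooth ∧ Y =ᶠ[𝓝 x] X ∧
      ∀ y, ∃ c : ℝ, Y y = c • X y ∧ (c = 0 ∨ y ∈ u) := by
  obtain ⟨f, -, hf⟩ := (SmoothBumpFunction.nhds_basis_tsupport (I := 𝓘(ℝ, E)) x).mem_iff.1
    (inter_mem hX hu)
  refine ⟨fun y => f y • X y, fun y => ?_, ?_, fun y => ⟨f y, rfl, ?_⟩⟩
  · by_cases hy : y ∈ tsupport f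
    · exact ContMDiffAt.smul_section f.contMDiffAt (hf hy).1
    · refine VField.IsSmoothAt.congr_of_eventuallyEq (X := fun _ => 0)
        (Bundle.contMDiff_zeroSection ℝ (TangentSpace 𝓘(ℝ, E) : M → Type _) y) ?_
      filter_upwards [(isClosed_tsupport f).isOpen_compl.mem_nhds hy] with z hz
      rw [image_eq_zero_of_notMem_tsupport hz, zero_smul]
  · filter_upwards [f.eventuallyEq_one] with y hy
    rw [hy, Pi.one_apply, one_smul]
  · by_cases hy : y ∈ tsupport f
    · exact Or.inr (hf hy).2
    · exact Or.inl (image_eq_zero_of_notMem_tsupport hy)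

/-- In finite dimension it suffices to test on fixed vectors `v`; the result is the coordinate
expression of `A` applied to the constant field `v`. -/
lemma contDiffOn_chartOp [FiniteDimensional ℝ E] (hφ : φ ∈ IsManifold.maximalAtlas 𝓘(ℝ, E) ∞ M)
    {A : OpField E M} (hA : A.IsSmooth) : ContDiffOn ℝ ∞ (chartOp φ A) φ.target := by
  have hcomplete : CompleteSpace E := FiniteDimensional.complete ℝ E
  have hd := mdifferentiable_of_mem_maximalAtlas hφ
  refine contDiffOn_clm_apply.2 fun v y hy => ContDiffAt.contDiffWithinAt ?_
  have h : VField.IsSmoothAt (A.app (ofChart φ fun _ => v)) (φ.symm y) :=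
    (isSmoothAt_ofChart hφ (φ.map_target hy) contDiffAt_const).app hA
  refine (h.contDiffAt_mpullback_symm hφ hy).congr_of_eventuallyEq ?_
  filter_upwards [φ.open_target.mem_nhds hy] with z hz
  rw [mpullback_symm_apply hd _ hz, OpField.app, ofChart_symm_apply hd _ hz]
  rfl

end Charts

/-! ### Smooth eigenvalues and integrability on the manifold. -/

section Integrability

open Polynomial

variable {E : Type*} [NormedAddCommGroup E] [NormedSpace ℝ E] [FiniteDimensional ℝ E]
  {M : Type*} [TopologicalSpace M] [ChartedSpace E M] {φ : OpenPartialHomeomorph M E}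

lemma mem_iSup_maxGenEigenspace_iff (hφ : φ.MDifferentiable 𝓘(ℝ, E) 𝓘(ℝ, E)) (A : OpField E M)
    {y : E} (hy : y ∈ φ.target) {ι : Type*} {c : ι → ℝ} (hc : Function.Injective c)
    (S : Finset ι) (v : TangentSpace 𝓘(ℝ, E) (φ.symm y)) :
    v ∈ ⨆ i ∈ S, Module.End.maxGenEigenspace (A (φ.symm y)).toLinearMap (c i) ↔
      mfderiv 𝓘(ℝ, E) 𝓘(ℝ, E) φ (φ.symm y) v ∈
        (aeval (chartOp φ A y) (∏ i ∈ S, (X - C (c i)) ^ Module.finrank ℝ E)).ker := by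
  have : FiniteDimensional ℝ (TangentSpace 𝓘(ℝ, E) (φ.symm y)) :=
    inferInstanceAs (FiniteDimensional ℝ E)
  rw [iSup_maxGenEigenspace_eq_ker _ hc, LinearMap.mem_ker]
  have h := map_aeval_of_intertwine (f := (A (φ.symm y)).toLinearMap) (g := chartOp φ A y)
    (chartEquiv hφ hy).toLinearMap (mfderiv_apply_eq_chartOp hφ A hy)
    (∏ i ∈ S, (X - C (c i)) ^ Module.finrank ℝ E) v
  refine Iff.trans ?_ (Eq.congr_left h)
  exact ((chartEquiv hφ hy).map_eq_zero_iff).symm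

lemma finrank_ker_aeval_chartOp (hφ : φ.MDifferentiable 𝓘(ℝ, E) 𝓘(ℝ, E)) (A : OpField E M)
    {y : E} (hy : y ∈ φ.target) {ι : Type*} {c : ι → ℝ} (hc : Function.Injective c)
    (S : Finset ι) :
    Module.finrank ℝ
      (aeval (chartOp φ A y) (∏ i ∈ S, (X - C (c i)) ^ Module.finrank ℝ E)).ker =
      ∑ i ∈ S, Module.finrank ℝ (Module.End.maxGenEigenspace (A (φ.symm y)).toLinearMap (c i)) := by
  have : FiniteDimensional ℝ (TangentSpace 𝓘(ℝ, E) (φ.symm y)) :=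
    inferInstanceAs (FiniteDimensional ℝ E)
  rw [← finrank_iSup_maxGenEigenspace _ hc]
  have h := LinearEquiv.finrank_map_eq (chartEquiv hφ hy)
    (⨆ i ∈ S, Module.End.maxGenEigenspace (A (φ.symm y)).toLinearMap (c i))
  have hmap : Submodule.map (chartEquiv hφ hy).toLinearMap
      (⨆ i ∈ S, Module.End.maxGenEigenspace (A (φ.symm y)).toLinearMap (c i)) =
      (aeval (chartOp φ A y) (∏ i ∈ S, (X - C (c i)) ^ Module.finrank ℝ E)).ker := by
    ext w
    constructor
    · rintro ⟨v, hv, rfl⟩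
      exact (mem_iSup_maxGenEigenspace_iff hφ A hy hc S v).1 hv
    · intro hw
      obtain ⟨v, rfl⟩ := (chartEquiv hφ hy).surjective w
      exact ⟨v, (mem_iSup_maxGenEigenspace_iff hφ A hy hc S v).2 hw, rfl⟩
  exact (congrArg (fun K : Submodule ℝ E => Module.finrank ℝ K) hmap.symm).trans h

variable [IsManifold 𝓘(ℝ, E) ∞ M]

/-- A continuous eigenvalue of constant algebraic multiplicity is smooth. -/
theorem contMDiff_of_finrank_eigenDistribution {A : OpField E M} (hA : A.IsSmooth) {μ : M → ℝ}
    (hμ : Continuous μ) {r : ℕ}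
    (hr : ∀ x, Module.finrank ℝ (eigenDistribution A μ x) = r + 1) :
    ContMDiff 𝓘(ℝ, E) 𝓘(ℝ, ℝ) ∞ μ := by
  intro x
  have hφ := IsManifold.chart_mem_maximalAtlas (I := 𝓘(ℝ, E)) (n := ∞) x
  have hx := mem_chart_source E x
  generalize chartAt E x = φ at hφ hx
  have hd := mdifferentiable_of_mem_maximalAtlas hφ
  have hy := φ.map_source hx
  have hL : ContDiffAt ℝ ∞ (chartOp φ A) (φ x) :=
    (contDiffOn_chartOp hφ hA).contDiffAt (φ.open_target.mem_nhds hy)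
  have h : ContDiffAt ℝ ∞ (fun y => μ (φ.symm y)) (φ x) := by
    refine contDiffAt_of_rootMultiplicity_eq (p := fun y => (chartOp φ A y).toLinearMap.charpoly)
      (n := Module.finrank ℝ E) (r := r) (fun y => (LinearMap.charpoly_natDegree _).le)
      (fun y => (LinearMap.charpoly_monic _).ne_zero) (fun k => contDiffAt_charpoly_coeff hL k)
      (hμ.continuousAt.comp (φ.continuousAt_symm hy)) ?_
    filter_upwards [φ.open_target.mem_nhds hy] with y hy
    rw [← finrank_maxGenEigenspace_eq_rootMultiplicity_chartOp hd A hy]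
    exact hr _
  refine (ContMDiffAt.comp x h.contMDiffAt
    (contMDiffAt_of_mem_maximalAtlas hφ hx)).congr_of_eventuallyEq ?_
  filter_upwards [φ.open_source.mem_nhds hx] with z hz
  rw [Function.comp_apply, φ.left_inv hz]

/-- Sums of generalized eigen-distributions are integrable. -/
theorem isIntegrable_iSup_eigenDistribution [T2Space M] {A : OpField E M} (hA : A.IsSmooth)
    {ι : Type*} {eig : ι → M → ℝ} (heig : ∀ i, ContMDiff 𝓘(ℝ, E) 𝓘(ℝ, ℝ) ∞ (eig i))
    (hinj : ∀ x, Function.Injective fun i => eig i x)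
    (hrank : ∀ i, ∃ r : ℕ, ∀ x, Module.finrank ℝ (eigenDistribution A (eig i) x) = r)
    {m : ℕ} (hm : 1 ≤ m)
    (htors : ∀ X Y : VField E M, X.IsSmooth → Y.IsSmooth → ∀ x, torsion A m X Y x = 0)
    (S : Finset ι) :
    Distribution.IsIntegrable fun x => ⨆ i ∈ S, eigenDistribution A (eig i) x := by
  intro x
  have hcomplete : CompleteSpace E := FiniteDimensional.complete ℝ E
  have hφ := IsManifold.chart_mem_maximalAtlas (I := 𝓘(ℝ, E)) (n := ∞) x
  have hx := mem_chart_source E x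
  generalize chartAt E x = φ at hφ hx
  have hd := mdifferentiable_of_mem_maximalAtlas hφ
  have hy := φ.map_source hx
  have htgt : ∀ᶠ y in 𝓝 (φ x), y ∈ φ.target := φ.open_target.mem_nhds hy
  -- In coordinates the distribution is the kernel of `Q`, smooth because the eigenvalues are, with
  -- constant rank equal to the sum of the individual ranks.
  let Q : E → E →L[ℝ] E := fun y =>
    aeval (chartOp φ A y) (∏ i ∈ S, (Polynomial.X - C (eig i (φ.symm y))) ^ Module.finrank ℝ E)
  have hQmem : ∀ y ∈ φ.target, ∀ v : TangentSpace 𝓘(ℝ, E) (φ.symm y),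
      v ∈ (⨆ i ∈ S, eigenDistribution A (eig i) (φ.symm y)) ↔
        mfderiv 𝓘(ℝ, E) 𝓘(ℝ, E) φ (φ.symm y) v ∈ (Q y).ker := fun y hy v =>
    mem_iSup_maxGenEigenspace_iff hd A hy (hinj (φ.symm y)) S v
  have hQ : ∀ᶠ y in 𝓝 (φ x), ContDiffAt ℝ ∞ Q y := by
    filter_upwards [htgt] with y hy
    refine contDiffAt_aeval_prod
      ((contDiffOn_chartOp hφ hA).contDiffAt (φ.open_target.mem_nhds hy)) (fun i => ?_) _ S
    exact contMDiffAt_iff_contDiffAt.1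
      ((heig i _).comp y (contMDiffAt_symm_of_mem_maximalAtlas hφ hy))
  have hQrank : ∀ᶠ y in 𝓝 (φ x),
      Module.finrank ℝ (Q y).ker = Module.finrank ℝ (Q (φ x)).ker := by
    filter_upwards [htgt] with y hy'
    refine (finrank_ker_aeval_chartOp hd A hy' (hinj (φ.symm y)) S).trans
      (Eq.trans (Finset.sum_congr rfl fun i _ => ?_)
        (finrank_ker_aeval_chartOp hd A hy (hinj (φ.symm (φ x))) S).symm)
    obtain ⟨r, hr⟩ := hrank i
    exact (hr _).trans (hr _).symm
  have hinv : ∀ᶠ y in 𝓝 (φ x), ∀ U V : E → E, (∀ᶠ z in 𝓝 y, ContDiffAt ℝ ∞ U z) →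
      (∀ᶠ z in 𝓝 y, ContDiffAt ℝ ∞ V z) → (∀ᶠ z in 𝓝 y, U z ∈ (Q z).ker) →
      (∀ᶠ z in 𝓝 y, V z ∈ (Q z).ker) → VectorField.lieBracket ℝ U V y ∈ (Q y).ker := by
    filter_upwards [htgt] with y hy U V hU hV hUQ hVQ
    have hc : Tendsto φ (𝓝 (φ.symm y)) (𝓝 y) := by
      have := φ.continuousAt (φ.map_target hy)
      rwa [ContinuousAt, φ.right_inv hy] at this
    -- The torsion hypothesis concerns global fields, so local sections are cut off by a bump
    -- function. Multiplication by scalars keeps them in the distribution, and the bracket at the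
    -- point sees only the germ.
    have hext : ∀ U : E → E, (∀ᶠ z in 𝓝 y, ContDiffAt ℝ ∞ U z) →
        (∀ᶠ z in 𝓝 y, U z ∈ (Q z).ker) → ∃ Y : VField E M, Y.IsSmooth ∧
          Y =ᶠ[𝓝 (φ.symm y)] ofChart φ U ∧
          ∀ z, Y z ∈ ⨆ i ∈ S, eigenDistribution A (eig i) z := by
      intro U hU hUQ
      have hsrc := φ.open_source.mem_nhds (φ.map_target hy)
      obtain ⟨Y, hY, hYe, hYc⟩ := exists_isSmooth_eventuallyEq
        (X := ofChart φ U) (x := φ.symm y)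
        (by
          filter_upwards [hsrc, hc.eventually hU] with z hz hUz
          exact isSmoothAt_ofChart hφ hz hUz)
        (inter_mem hsrc (hc.eventually hUQ))
      refine ⟨Y, hY, hYe, fun z => ?_⟩
      obtain ⟨c, hc, rfl | ⟨hz, hUz⟩⟩ := hYc z
      · rw [hc, zero_smul]
        exact Submodule.zero_mem _
      · rw [hc]
        refine Submodule.smul_mem _ c ?_
        have hz' := φ.map_source hz
        have h := hQmem (φ z) hz' (ofChart φ U (φ.symm (φ z)))
        rw [ofChart_symm_apply hd U hz', mfderiv_mfderiv_symm_apply hd hz',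
          ← ofChart_symm_apply hd U hz', φ.left_inv hz] at h
        exact h.2 hUz
    obtain ⟨X', hX', hXe, hXS⟩ := hext U hU hUQ
    obtain ⟨Y', hY', hYe, hYS⟩ := hext V hV hVQ
    have hbr := (hQmem y hy _).1
      (mlieBracket_mem_iSup_eigenDistribution hA heig hinj hm htors S hX' hY' hXS hYS (φ.symm y))
    rw [← mpullback_symm_apply hd _ hy] at hbr
    have hman : IsManifold 𝓘(ℝ, E) (minSmoothness ℝ 2) M := by
      rw [minSmoothness_of_isRCLikeNormedField]; infer_instance
    have hman3 : IsManifold 𝓘(ℝ, E) (minSmoothness ℝ 3) M := by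
      rw [minSmoothness_of_isRCLikeNormedField]; infer_instance
    rw [VectorField.mpullback_mlieBracket (n := ∞) (VField.IsSmooth.mdifferentiableAt hX' _)
      (VField.IsSmooth.mdifferentiableAt hY' _) (contMDiffAt_symm_of_mem_maximalAtlas hφ hy)
      (by rw [minSmoothness_of_isRCLikeNormedField]; exact ENat.LEInfty.out)] at hbr
    have heq : ∀ (U : E → E) (X : VField E M), X =ᶠ[𝓝 (φ.symm y)] ofChart φ U →
        VectorField.mpullback 𝓘(ℝ, E) 𝓘(ℝ, E) φ.symm X =ᶠ[𝓝 y] U := by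
      intro U X h
      filter_upwards [φ.open_target.mem_nhds hy, (φ.continuousAt_symm hy).eventually h]
        with z hz hXz
      rw [mpullback_symm_apply hd _ hz, hXz, ← mpullback_symm_apply hd _ hz,
        mpullback_symm_ofChart hd U hz]
    have hlie := (heq U X' hXe).mlieBracket_vectorField_eq (heq V Y' hYe)
    exact (congrArg (fun w : E => w ∈ (Q y).ker)
      (hlie.trans (mlieBracket_eq_lieBracket U V y))).mp hbr
  obtain ⟨e, hxe, he, he', W, hW⟩ := exists_flat_chart_of_ker hQ hQrank hinv
  -- The flat chart describes the kernel of `Q` only near `φ x`, so its domain is shrunk.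
  obtain ⟨s, hsW, hs, hxs⟩ := eventually_nhds_iff.1 hW
  let e' := e.restrOpen s hs
  have hmem : φ.trans e' ∈ IsManifold.maximalAtlas 𝓘(ℝ, E) ∞ M := by
    refine OpenPartialHomeomorph.mem_maximalAtlas_of_contMDiffOn _ ?_ ?_
    · refine (he.contMDiffOn).comp
        ((contMDiffOn_of_mem_maximalAtlas hφ).mono fun z hz => hz.1) fun z hz => hz.2.1
    · refine (contMDiffOn_symm_of_mem_maximalAtlas hφ).comp
        ((he'.contMDiffOn).mono fun z hz => hz.1.1) fun z hz => hz.2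
  refine ⟨φ.trans e', hmem, ⟨hx, hxe, hxs⟩, W, fun z hz v => ?_⟩
  have hzs : z ∈ φ.source := hz.1
  have hze : φ z ∈ e.source := hz.2.1
  have hcomp : mfderiv 𝓘(ℝ, E) 𝓘(ℝ, E) (φ.trans e') z v =
      fderiv ℝ e (φ z) (mfderiv 𝓘(ℝ, E) 𝓘(ℝ, E) φ z v) := by
    have hed : MDifferentiableAt 𝓘(ℝ, E) 𝓘(ℝ, E) e (φ z) :=
      ((he.contDiffAt (e.open_source.mem_nhds hze)).differentiableAt (by simp)).mdifferentiableAt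
    have h := mfderiv_comp z hed (hd.mdifferentiableAt hzs)
    rw [mfderiv_eq_fderiv] at h
    exact DFunLike.congr_fun h v
  have h := hQmem (φ z) (φ.map_source hzs)
  rw [φ.left_inv hzs] at h
  rw [hcomp]
  exact (h v).trans (hsW (φ z) hz.2.2 hze _)

end Integrability

end NijenhuisHaantjes

end

theorem mainTheorem1
    {E : Type*} [NormedAddCommGroup E] [NormedSpace ℝ E] [FiniteDimensional ℝ E]
    {M : Type*} [TopologicalSpace M] [T2Space M] [ChartedSpace E M] [IsManifold 𝓘(ℝ, E) ∞ M]
    (A : NijenhuisHaantjes.OpField E M) (hA : A.IsSmooth)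
    -- the eigenvalue fields: continuous, distinct at every point, exhausting the spectrum of `A`,
    -- which is real
    (s : ℕ) (eig : Fin s → M → ℝ)
    (heig_cont : ∀ i, Continuous (eig i))
    (heig_distinct : ∀ x : M, Function.Injective (fun i => eig i x))
    (heig_spec : ∀ (x : M) (c : ℝ),
      Module.End.HasEigenvalue (A x).toLinearMap c ↔ ∃ i, eig i x = c)
    (hreal : A.HasRealSpectrum)
    -- the generalized eigen-distributions have constant rank
    (hrank : ∀ i, ∃ r : ℕ, ∀ x : M,
      Module.finrank ℝ (NijenhuisHaantjes.eigenDistribution A (eig i) x) = r)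
    -- the generalized torsion of some level `m ≥ 1` vanishes identically
    (m : ℕ) (hm : 1 ≤ m)
    (htors : ∀ X Y : NijenhuisHaantjes.VField E M, X.IsSmooth → Y.IsSmooth →
      ∀ x : M, NijenhuisHaantjes.torsion A m X Y x = 0) :
    (∀ i, NijenhuisHaantjes.Distribution.IsIntegrable
      (NijenhuisHaantjes.eigenDistribution A (eig i))) ∧
    ∀ S : Finset (Fin s), NijenhuisHaantjes.Distribution.IsIntegrable
      (fun x : M => ⨆ i ∈ S, NijenhuisHaantjes.eigenDistribution A (eig i) x) := by
  have hsmooth : ∀ i, ContMDiff 𝓘(ℝ, E) 𝓘(ℝ, ℝ) ∞ (eig i) := by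
    intro i
    obtain ⟨r, hr⟩ := hrank i
    -- Rank zero is impossible at a point of `M`, since `eig i x` has an eigenvector; the remaining
    -- form `r + 1` is what smoothness of the eigenvalue requires.
    obtain _ | r := r
    · intro x
      have : FiniteDimensional ℝ (TangentSpace 𝓘(ℝ, E) x) :=
        inferInstanceAs (FiniteDimensional ℝ E)
      refine absurd (Submodule.finrank_eq_zero.1 (hr x)) ?_
      exact ne_bot_of_le_ne_bot ((heig_spec x (eig i x)).2 ⟨i, rfl⟩)
        ((Module.End.genEigenspace _ _).monotone le_top)
    · exact NijenhuisHaantjes.contMDiff_of_finrank_eigenDistribution hA (heig_cont i) hr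
  have hmain := fun S => NijenhuisHaantjes.isIntegrable_iSup_eigenDistribution hA hsmooth
    heig_distinct hrank hm htors S
  refine ⟨fun i => ?_, hmain⟩
  simpa only [Finset.mem_singleton, iSup_iSup_eq_left] using hmain {i}
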